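/- Let $M$ be a smooth three-dimensional manifold with a smooth complex-valued metric $g_{ab}$, i.e. a smooth field of nondegenerate symmetric complex bilinear forms on $T^{\mathbb C}M=\mathbb C\otimes TM$ (for instance the complex-linear extension of a pseudo-Riemannian metric of any signature), with Levi-Civita connection $\nabla_a$. The Riemann tensor is defined by $R_{abd}{}^{c}V^d=\nabla_a\nabla_bV^c-\nabla_b\nabla_aV^c$, the Ricci tensor by $R_{ab}=R_{acb}{}^{c}$, and $R=g^{ab}R_{ab}$, $S=\tfrac1{12}R$, $\Phi_{ab}=R_{ab}-\tfrac13Rg_{ab}$, $\mathrm P_{ab}=-\Phi_{ab}-Sg_{ab}$; the Cotton tensor is $A_{abc}=\nabla_b\mathrm P_{ca}-\nabla_c\mathrm P_{ba}$. Let $\mathcal N\subset T^{\mathbb C}M$ be a null structure, i.e. a smooth complex line subbundle with $g_{ab}k^ak^b=0$ for all $k^a\in\mathcal N$. In a null frame $(k,\ell,n)$ of $T^{\mathbb C}_pM$, i.e. one with $g_{ab}=2k_{(a}\ell_{b)}-2n_an_b$, every null direction is spanned by $\xi=s^2k+2st\,n+t^2\ell$ for a unique $[s:t]\in\mathbb{CP}^1$,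 and $\tfrac12\Phi_{ab}\xi^a\xi^b$ is a homogeneous quartic in $(s,t)$. The null structure $\mathcal N$ is multiple principal at $p$ if $\mathcal N_p$ is given by a multiple root of this quartic, and $\Phi$ is of Petrov type N at $p$ if the quartic is the fourth power of a nonzero linear form (in particular $\Phi\neq0$ at $p$). Suppose that at every point of $M$ the null structure $\mathcal N$ is multiple principal and $\Phi$ is of Petrov type N, and that for every $k^a\in\mathcal N$ $$k^c\left(A_{abc}-g_{ca}\nabla_bS\right)=0,\qquad k^aA_{abc}=0,\qquad k_{[a}\nabla_{b]}S=0 .$$ Then $\mathcal N$ is co-geodetic: $g(\nabla_XY,Z)=0$ for all (local) smooth sections $X,Y$ of $\mathcal N^\perp$ and $Z$ of $\mathcal N$. -/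

import Mathlib

open scoped Manifold ContDiff TensorProduct Polynomial

noncomputable section

namespace NullGeometry

/-- The coordinate space `ℝ³`. -/
abbrev E3 : Type := EuclideanSpace ℝ (Fin 3)

/-! ### Tensor calculus in coordinates

`G : E3 → Matrix (Fin 3) (Fin 3) ℂ` stands for the components `g_{ab}` of a complex-valued metric
in a coordinate system; an index position is an argument of type `Fin 3`. -/

/-- Partial derivative `∂_i f` of a complex-valued function of three real coordinates. -/
def pd (i : Fin 3) (f : E3 → ℂ) (y : E3) : ℂ :=
  fderiv ℝ f y (EuclideanSpace.single i (1 : ℝ))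

/-- Christoffel symbols `Γ^c_{ab} = ½ g^{cd} (∂_a g_{bd} + ∂_b g_{ad} - ∂_d g_{ab})` of the
Levi-Civita connection. -/
def christoffel (G : E3 → Matrix (Fin 3) (Fin 3) ℂ) (c a b : Fin 3) (y : E3) : ℂ :=
  (1 / 2) * ∑ d, (G y)⁻¹ c d *
    (pd a (fun x => G x b d) y + pd b (fun x => G x a d) y - pd d (fun x => G x a b) y)

/-- Riemann tensor `R_{abd}{}^c`, with `R_{abd}{}^c V^d = ∇_a ∇_b V^c - ∇_b ∇_a V^c`. -/
def riemann (G : E3 → Matrix (Fin 3) (Fin 3) ℂ) (a b d c : Fin 3) (y : E3) : ℂ :=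
  pd a (christoffel G c b d) y - pd b (christoffel G c a d) y
    + ∑ e, (christoffel G c a e y * christoffel G e b d y
            - christoffel G c b e y * christoffel G e a d y)

/-- Ricci tensor `R_{ab} = R_{acb}{}^c`. -/
def ricci (G : E3 → Matrix (Fin 3) (Fin 3) ℂ) (a b : Fin 3) (y : E3) : ℂ :=
  ∑ c, riemann G a c b c y

/-- Ricci scalar `R = g^{ab} R_{ab}`. -/
def scalarR (G : E3 → Matrix (Fin 3) (Fin 3) ℂ) (y : E3) : ℂ :=
  ∑ a, ∑ b, (G y)⁻¹ a b * ricci G a b y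

/-- `S = R / 12`. -/
def scalarS (G : E3 → Matrix (Fin 3) (Fin 3) ℂ) (y : E3) : ℂ :=
  scalarR G y / 12

/-- Tracefree Ricci tensor `Φ_{ab} = R_{ab} - ⅓ R g_{ab}`. -/
def tfRicci (G : E3 → Matrix (Fin 3) (Fin 3) ℂ) (a b : Fin 3) (y : E3) : ℂ :=
  ricci G a b y - (1 / 3) * scalarR G y * G y a b

/-- Schouten (Rho) tensor `P_{ab} = - Φ_{ab} - (R / 12) g_{ab}`. -/
def schouten (G : E3 → Matrix (Fin 3) (Fin 3) ℂ) (a b : Fin 3) (y : E3) : ℂ :=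
  - tfRicci G a b y - scalarS G y * G y a b

/-- Covariant derivative `∇_b T_{ca}` of a covariant 2-tensor. -/
def covDeriv₂ (G : E3 → Matrix (Fin 3) (Fin 3) ℂ) (T : Fin 3 → Fin 3 → E3 → ℂ)
    (b c a : Fin 3) (y : E3) : ℂ :=
  pd b (T c a) y - ∑ e, (christoffel G e b c y * T e a y + christoffel G e b a y * T c e y)

/-- Cotton tensor `A_{abc} = ∇_b P_{ca} - ∇_c P_{ba}`. -/
def cotton (G : E3 → Matrix (Fin 3) (Fin 3) ℂ) (a b c : Fin 3) (y : E3) : ℂ :=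
  covDeriv₂ G (schouten G) b c a y - covDeriv₂ G (schouten G) c b a y

/-- Components `(∇_X Y)^c = X^b (∂_b Y^c + Γ^c_{bd} Y^d)` of the covariant derivative of vector
fields. -/
def nablaVec (G : E3 → Matrix (Fin 3) (Fin 3) ℂ) (X Y : E3 → Fin 3 → ℂ)
    (y : E3) (c : Fin 3) : ℂ :=
  ∑ b, X y b * (pd b (fun x => Y x c) y + ∑ d, christoffel G c b d y * Y y d)

/-! ### Complexified tangent bundle, metrics and null structures on a 3-manifold -/

section Manifold

variable {M : Type*} [TopologicalSpace M] [ChartedSpace E3 M]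

/-- The complexified tangent space `T^ℂ_p M = ℂ ⊗ T_p M`. -/
abbrev CTangent (p : M) : Type := ℂ ⊗[ℝ] TangentSpace (𝓡 3) p

/-- The differential at `p` of the chart `e`. -/
def dChart (e : OpenPartialHomeomorph M E3) (p : M) : TangentSpace (𝓡 3) p →ₗ[ℝ] E3 :=
  (mfderiv (𝓡 3) (𝓡 3) e p).toLinearMap

/-- The differential at `y` of the inverse of the chart `e`. -/
def dChartSymm (e : OpenPartialHomeomorph M E3) (y : E3) :
    E3 →ₗ[ℝ] TangentSpace (𝓡 3) (e.symm y) :=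
  (mfderiv (𝓡 3) (𝓡 3) e.symm y).toLinearMap

/-- The coordinate vector `∂/∂x^i` of the chart `e` at the point with coordinates `y`. -/
def coordVec (e : OpenPartialHomeomorph M E3) (y : E3) (i : Fin 3) : CTangent (e.symm y) :=
  (1 : ℂ) ⊗ₜ[ℝ] dChartSymm e y (EuclideanSpace.single i (1 : ℝ))

/-- The components in the chart `e` of a complex tangent vector at `p`, through the
complex-linear extension of the differential of `e`. -/
def coord (e : OpenPartialHomeomorph M E3) (p : M) : CTangent p →ₗ[ℂ] (Fin 3 → ℂ) :=
  (Algebra.TensorProduct.basis ℂ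
      (EuclideanSpace.basisFun (Fin 3) ℝ).toBasis).equivFun.toLinearMap ∘ₗ
    LinearMap.baseChange ℂ (dChart e p)

/-- The field of components in the chart `e` of a complex vector field `V`. -/
def coordField (e : OpenPartialHomeomorph M E3) (V : ∀ p : M, CTangent p) :
    E3 → Fin 3 → ℂ :=
  fun y => coord e (e.symm y) (V (e.symm y))

/-- `V` is a smooth section of `T^ℂ M` over the set `U`. -/
def SmoothFieldOn (V : ∀ p : M, CTangent p) (U : Set M) : Prop :=
  ∀ e ∈ atlas E3 M, ContDiffOn ℝ ∞ (coordField e V) (e.target ∩ e.symm ⁻¹' U)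

/-- The components `g_{ij} = g(∂_i, ∂_j)` in the chart `e` of a field of bilinear forms. -/
def coordForm (g : ∀ p : M, LinearMap.BilinForm ℂ (CTangent p))
    (e : OpenPartialHomeomorph M E3) (y : E3) : Matrix (Fin 3) (Fin 3) ℂ :=
  Matrix.of fun i j => g (e.symm y) (coordVec e y i) (coordVec e y j)

variable (M) in
/-- A smooth complex-valued metric: a smooth field of nondegenerate symmetric complex bilinear
forms on the complexified tangent spaces.  The complex-linear extension of a pseudo-Riemannian
metric of any signature is an instance. -/
structure ComplexMetric where
  form : ∀ p : M, LinearMap.BilinForm ℂ (CTangent p)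
  symm : ∀ p, (form p).IsSymm
  nondegenerate : ∀ p, (form p).Nondegenerate
  smooth : ∀ e ∈ atlas E3 M, ∀ i j,
    ContDiffOn ℝ ∞ (fun y => coordForm form e y i j) e.target

/-- The components of the metric in the chart `e`. -/
def ComplexMetric.comp (g : ComplexMetric M) (e : OpenPartialHomeomorph M E3) :
    E3 → Matrix (Fin 3) (Fin 3) ℂ :=
  coordForm g.form e

/-- A null structure: a smooth complex line subbundle of `T^ℂ M` that is null for `g`. -/
structure NullStructure (g : ComplexMetric M) where
  line : ∀ p : M, Submodule ℂ (CTangent p)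
  finrank_line : ∀ p, Module.finrank ℂ (line p) = 1
  null : ∀ p, ∀ k ∈ line p, g.form p k k = 0
  smooth : ∀ p : M, ∃ U : Set M, IsOpen U ∧ p ∈ U ∧ ∃ k : ∀ q : M, CTangent q,
    SmoothFieldOn k U ∧ ∀ q ∈ U, line q = Submodule.span ℂ {k q}

namespace NullStructure

variable {g : ComplexMetric M}

/-- The fibre at `p` of the orthogonal complement `N^⊥`. -/
def perp (N : NullStructure g) (p : M) : Set (CTangent p) :=
  {v | ∀ k ∈ N.line p, g.form p v k = 0}

/-- `N` is co-geodetic: `g(∇_X Y, Z) = 0` for all sections `X, Y` of `N^⊥` and `Z` of `N`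
over any open set. -/
def IsCoGeodetic (N : NullStructure g) : Prop :=
  ∀ U : Set M, IsOpen U → ∀ X Y Z : ∀ q : M, CTangent q,
    SmoothFieldOn X U → SmoothFieldOn Y U → SmoothFieldOn Z U →
    (∀ q ∈ U, X q ∈ N.perp q) → (∀ q ∈ U, Y q ∈ N.perp q) → (∀ q ∈ U, Z q ∈ N.line q) →
    ∀ e ∈ atlas E3 M, ∀ q ∈ e.source, q ∈ U →
      ∑ a, ∑ b, g.comp e (e q) a b *
        nablaVec (g.comp e) (coordField e X) (coordField e Y) (e q) a *
        coord e q (Z q) b = 0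

end NullStructure

/-! ### Petrov classification of the tracefree Ricci tensor at a point -/

/-- `Φ_{ab} v^a w^b` at `p`, computed in the chart `e`. -/
def ComplexMetric.Phi (g : ComplexMetric M) (e : OpenPartialHomeomorph M E3) (p : M)
    (v w : CTangent p) : ℂ :=
  ∑ a, ∑ b, tfRicci (g.comp e) a b (e p) * coord e p v a * coord e p w b

/-- A frame `(k, ℓ, n)` of `T^ℂ_p M` in which `g_{ab} = 2 k_{(a} ℓ_{b)} - 2 n_a n_b`. -/
structure IsNullFrame (g : ComplexMetric M) (p : M) (k l n : CTangent p) : Prop where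
  kk : g.form p k k = 0
  ll : g.form p l l = 0
  kl : g.form p k l = 1
  kn : g.form p k n = 0
  ln : g.form p l n = 0
  nn : g.form p n n = -1 / 2

/-- The null vector `ξ = s² k + 2 s t n + t² ℓ` with homogeneous coordinates `[s : t]` in `ℂP¹`. -/
def nullVec {p : M} (k l n : CTangent p) (s t : ℂ) : CTangent p :=
  s ^ 2 • k + (2 * s * t) • n + t ^ 2 • l

/-- The quartic polynomial `½ Φ_{ab} ξ^a ξ^b` in `z`, where `ξ = k + 2 z n + z² ℓ`. -/
def ricciPoly (g : ComplexMetric M) (e : OpenPartialHomeomorph M E3) (p : M)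
    (k l n : CTangent p) : ℂ[X] :=
  Polynomial.C (g.Phi e p k k / 2)
    + Polynomial.C (g.Phi e p k n + g.Phi e p n k) * Polynomial.X
    + Polynomial.C ((g.Phi e p k l + g.Phi e p l k) / 2 + 2 * g.Phi e p n n) * Polynomial.X ^ 2
    + Polynomial.C (g.Phi e p l n + g.Phi e p n l) * Polynomial.X ^ 3
    + Polynomial.C (g.Phi e p l l / 2) * Polynomial.X ^ 4

/-- `N` is principal at `p`: `Φ_{ab} ξ^a ξ^b = 0` for the vectors `ξ` of `N_p`. -/
def NullStructure.IsPrincipalAt {g : ComplexMetric M} (N : NullStructure g) (p : M) : Prop :=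
  ∀ e ∈ atlas E3 M, p ∈ e.source → ∀ ξ ∈ N.line p, g.Phi e p ξ ξ = 0

/-- `N` is multiple principal at `p`: it is principal, and the root `z` of the quartic polynomial
that determines it is a multiple one. -/
def NullStructure.IsMultiplePrincipalAt {g : ComplexMetric M} (N : NullStructure g)
    (p : M) : Prop :=
  N.IsPrincipalAt p ∧
  ∀ e ∈ atlas E3 M, p ∈ e.source → ∃ k l n : CTangent p, IsNullFrame g p k l n ∧
    ∃ z : ℂ, nullVec k l n 1 z ∈ N.line p ∧
      (Polynomial.X - Polynomial.C z) ^ 2 ∣ ricciPoly g e p k l n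

/-- `Φ` is of Petrov type N (and hence nonzero) at `p`: in a null frame the homogeneous quartic
`½ Φ_{ab} ξ^a ξ^b` in `[s : t]` is the fourth power of a nonzero linear form, that is, its roots in
`ℂP¹` have the partition `{4}`. -/
def ComplexMetric.IsTypeNAt (g : ComplexMetric M) (p : M) : Prop :=
  ∀ e ∈ atlas E3 M, p ∈ e.source → ∃ k l n : CTangent p, IsNullFrame g p k l n ∧
    ∃ α β : ℂ, (α, β) ≠ (0, 0) ∧ ∀ s t : ℂ,
      g.Phi e p (nullVec k l n s t) (nullVec k l n s t) / 2 = (α * s + β * t) ^ 4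

/-- The curvature conditions on `N` at `p`: every `k ∈ N_p` satisfies
`k^c (A_{abc} - g_{ca} ∇_b S) = 0`, `k^a A_{abc} = 0` and `k_a ∇_b S - k_b ∇_a S = 0`
(in components with respect to the charts at `p`). -/
def NullStructure.TypeNConditionAt {g : ComplexMetric M} (N : NullStructure g) (p : M) : Prop :=
  ∀ e ∈ atlas E3 M, p ∈ e.source → ∀ k ∈ N.line p,
    (∀ a b, ∑ c, coord e p k c *
      (cotton (g.comp e) a b c (e p) - g.comp e (e p) c a * pd b (scalarS (g.comp e)) (e p)) = 0) ∧
    (∀ b c, ∑ a, coord e p k a * cotton (g.comp e) a b c (e p) = 0) ∧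
    (∀ a b, (∑ c, g.comp e (e p) a c * coord e p k c) * pd b (scalarS (g.comp e)) (e p)
      - (∑ c, g.comp e (e p) b c * coord e p k c) * pd a (scalarS (g.comp e)) (e p) = 0)

end Manifold

end NullGeometry

end

namespace NullGeometry

/-! ### Calculus of partial derivatives -/

/-! At every point, type N and trace-freeness force Φ = 2 κ⊗κ, with κ the covector of a null vector
k (`exists_adapted`); as N is principal and null, k spans N. The claim is thus that (∇_X κ)(Y) = 0
for X, Y in k^⊥.

A smooth choice of κ would need a square root. Instead fix a point y and a constant vector l with
κ(l) = 1 at y, and put w = Φ(l, ·), ψ = Φ(l, l). These are smooth, w⊗w = ψΦ because Φ has rank one,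
and w = 2κ, ψ = 2 at y. With W = ∇w and q = dψ, differentiation at y gives ∇_c Φ_ab = W_ca κ_b + κ_a
W_cb - q_c κ_a κ_b.

The rest is pointwise algebra (`derivative_vanishes`). The trace gives W(·, k) = 0. The gradient
condition gives dS = σκ. The Cotton tensor contracted with k gives W(k, ·) = λκ with 2λ = q(k) + 2σ.
The contracted Bianchi identity ∇^cΦ_cb = 2∇_b S gives 2λ - 2W(n, n) - q(k) = 2σ, so W(n, n) = 0.
Hence W vanishes on k^⊥ = span(k, n), and differentiating w(Y) = 0 gives κ(∇_X Y) = 0.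

The Bianchi identity is derived in coordinates, with the connection and curvature treated as
matrices. -/

theorem pd_congr {Ω : Set E3} (hΩ : IsOpen Ω) {f h : E3 → ℂ} (hfh : ∀ x ∈ Ω, f x = h x)
    (i : Fin 3) {y : E3} (hy : y ∈ Ω) : pd i f y = pd i h y := by
  have : f =ᶠ[nhds y] h := Filter.eventuallyEq_of_mem (hΩ.mem_nhds hy) hfh
  simp only [pd, this.fderiv_eq]

theorem differentiableAt_of_smooth {Ω : Set E3} (hΩ : IsOpen Ω) {f : E3 → ℂ}
    (hf : ContDiffOn ℝ ∞ f Ω) {y : E3} (hy : y ∈ Ω) : DifferentiableAt ℝ f y :=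
  (hf.contDiffAt (hΩ.mem_nhds hy)).differentiableAt (by simp)

theorem smooth_pd {Ω : Set E3} (hΩ : IsOpen Ω) {f : E3 → ℂ} (hf : ContDiffOn ℝ ∞ f Ω)
    (i : Fin 3) : ContDiffOn ℝ ∞ (pd i f) Ω := by
  have h : ContDiffOn ℝ ∞ (fderiv ℝ f) Ω := hf.fderiv_of_isOpen hΩ (by simp)
  exact h.clm_apply contDiffOn_const

section rules

variable {Ω : Set E3} (hΩ : IsOpen Ω) {f h : E3 → ℂ} (hf : ContDiffOn ℝ ∞ f Ω)
  (hh : ContDiffOn ℝ ∞ h Ω) (i : Fin 3) {y : E3} (hy : y ∈ Ω)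

include hΩ hf hh hy

theorem pd_add : pd i (fun x => f x + h x) y = pd i f y + pd i h y := by
  simp [pd, fderiv_fun_add (differentiableAt_of_smooth hΩ hf hy)
    (differentiableAt_of_smooth hΩ hh hy)]

theorem pd_sub : pd i (fun x => f x - h x) y = pd i f y - pd i h y := by
  simp [pd, fderiv_fun_sub (differentiableAt_of_smooth hΩ hf hy)
    (differentiableAt_of_smooth hΩ hh hy)]

theorem pd_mul : pd i (fun x => f x * h x) y = pd i f y * h y + f y * pd i h y := by
  simp [pd, fderiv_fun_mul (differentiableAt_of_smooth hΩ hf hy)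
    (differentiableAt_of_smooth hΩ hh hy)]
  ring

end rules

theorem pd_neg (f : E3 → ℂ) (i : Fin 3) (y : E3) : pd i (fun x => - f x) y = - pd i f y := by
  simp [pd]

theorem pd_const (c : ℂ) (i : Fin 3) (y : E3) : pd i (fun _ => c) y = 0 := by
  simp [pd]

theorem pd_const_mul {Ω : Set E3} (hΩ : IsOpen Ω) {f : E3 → ℂ} (hf : ContDiffOn ℝ ∞ f Ω)
    (c : ℂ) (i : Fin 3) {y : E3} (hy : y ∈ Ω) :
    pd i (fun x => c * f x) y = c * pd i f y := by
  simp [pd_mul hΩ contDiffOn_const hf i hy, pd_const]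

theorem pd_sum {Ω : Set E3} (hΩ : IsOpen Ω) {ι : Type*} (s : Finset ι) {f : ι → E3 → ℂ}
    (hf : ∀ j ∈ s, ContDiffOn ℝ ∞ (f j) Ω) (i : Fin 3) {y : E3} (hy : y ∈ Ω) :
    pd i (fun x => ∑ j ∈ s, f j x) y = ∑ j ∈ s, pd i (f j) y := by
  simp [pd, fderiv_fun_sum fun j hj => differentiableAt_of_smooth hΩ (hf j hj) hy]

theorem pd_comm {Ω : Set E3} (hΩ : IsOpen Ω) {f : E3 → ℂ} (hf : ContDiffOn ℝ ∞ f Ω)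
    (i j : Fin 3) {y : E3} (hy : y ∈ Ω) : pd i (pd j f) y = pd j (pd i f) y := by
  have h : ContDiffOn ℝ ∞ (fderiv ℝ f) Ω := hf.fderiv_of_isOpen hΩ (by simp)
  have hd : DifferentiableAt ℝ (fderiv ℝ f) y :=
    (h.contDiffAt (hΩ.mem_nhds hy)).differentiableAt (by simp)
  have hs : IsSymmSndFDerivAt ℝ f y :=
    (hf.contDiffAt (hΩ.mem_nhds hy)).isSymmSndFDerivAt
      (by simpa using WithTop.coe_le_coe.2 (le_top : (2 : ℕ∞) ≤ ⊤))
  have key : ∀ a b : Fin 3, pd a (pd b f) y =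
      fderiv ℝ (fderiv ℝ f) y (EuclideanSpace.single a 1) (EuclideanSpace.single b 1) := by
    intro a b
    have : fderiv ℝ (fun x => fderiv ℝ f x (EuclideanSpace.single b (1 : ℝ))) y =
        (fderiv ℝ (fderiv ℝ f) y).flip (EuclideanSpace.single b 1) := by
      rw [fderiv_clm_apply hd (differentiableAt_const _)]
      simp
    change fderiv ℝ (fun x => fderiv ℝ f x (EuclideanSpace.single b (1 : ℝ))) y _ = _
    rw [this]; rfl
  rw [key, key, hs]

/-! ### Matrix-valued functions -/

/-- A matrix-valued function with smooth entries. -/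
def SmoothMat (Ω : Set E3) (F : E3 → Matrix (Fin 3) (Fin 3) ℂ) : Prop :=
  ∀ a b, ContDiffOn ℝ ∞ (fun x => F x a b) Ω

/-- Entrywise partial derivative. -/
noncomputable def pdMat (i : Fin 3) (F : E3 → Matrix (Fin 3) (Fin 3) ℂ) (y : E3) : Matrix (Fin 3) (Fin 3) ℂ :=
  Matrix.of fun a b => pd i (fun x => F x a b) y

theorem pdMat_apply (i : Fin 3) (F : E3 → Matrix (Fin 3) (Fin 3) ℂ) (y : E3) (a b : Fin 3) :
    pdMat i F y a b = pd i (fun x => F x a b) y := rfl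

section matrices

variable {Ω : Set E3} {F H : E3 → Matrix (Fin 3) (Fin 3) ℂ}

theorem SmoothMat.sub (hF : SmoothMat Ω F) (hH : SmoothMat Ω H) :
    SmoothMat Ω (fun x => F x - H x) := fun a b => (hF a b).sub (hH a b)

theorem SmoothMat.transpose (hF : SmoothMat Ω F) :
    SmoothMat Ω (fun x => (F x).transpose) := fun a b => hF b a

theorem SmoothMat.mul (hF : SmoothMat Ω F) (hH : SmoothMat Ω H) :
    SmoothMat Ω (fun x => F x * H x) := by
  intro a b
  simp only [Matrix.mul_apply]
  exact ContDiffOn.sum fun c _ => (hF a c).mul (hH c b)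

theorem SmoothMat.pdMat (hΩ : IsOpen Ω) (hF : SmoothMat Ω F) (i : Fin 3) :
    SmoothMat Ω (pdMat i F) := fun a b => smooth_pd hΩ (hF a b) i

theorem SmoothMat.det (hF : SmoothMat Ω F) : ContDiffOn ℝ ∞ (fun x => (F x).det) Ω := by
  simp only [Matrix.det_apply]
  exact ContDiffOn.sum fun σ _ => ContDiffOn.const_smul _ (contDiffOn_prod fun i _ => hF _ _)

/-- Cramer's rule: each entry is a cofactor divided by the nonvanishing determinant. -/
theorem SmoothMat.inv (hF : SmoothMat Ω F) (hdet : ∀ x ∈ Ω, (F x).det ≠ 0) :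
    SmoothMat Ω (fun x => (F x)⁻¹) := by
  intro a b
  have h : ∀ x, (F x)⁻¹ a b = (F x).det⁻¹ * ((F x).updateRow b (Pi.single a 1)).det := by
    intro x
    rw [Matrix.inv_def, Matrix.smul_apply, Matrix.adjugate_apply, Ring.inverse_eq_inv', smul_eq_mul]
  simp only [h]
  refine (hF.det.inv hdet).mul (SmoothMat.det fun c d => ?_)
  by_cases hc : c = b
  · subst hc
    simpa using contDiffOn_const
  · simpa [Matrix.updateRow_ne hc] using hF c d

theorem pdMat_congr (hΩ : IsOpen Ω) (hFH : ∀ x ∈ Ω, F x = H x) (i : Fin 3) {y : E3}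
    (hy : y ∈ Ω) : pdMat i F y = pdMat i H y := by
  ext a b
  exact pd_congr hΩ (fun x hx => by rw [hFH x hx]) i hy

theorem pdMat_transpose (i : Fin 3) (y : E3) :
    pdMat i (fun x => (F x).transpose) y = (pdMat i F y).transpose := rfl

theorem pdMat_const (A : Matrix (Fin 3) (Fin 3) ℂ) (i : Fin 3) (y : E3) :
    pdMat i (fun _ => A) y = 0 := by
  ext a b
  exact pd_const _ _ _

theorem pdMat_comm (hΩ : IsOpen Ω) (hF : SmoothMat Ω F) (i j : Fin 3) {y : E3} (hy : y ∈ Ω) :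
    pdMat i (pdMat j F) y = pdMat j (pdMat i F) y := by
  ext a b
  exact pd_comm hΩ (hF a b) i j hy

variable (hΩ : IsOpen Ω) (hF : SmoothMat Ω F) (hH : SmoothMat Ω H) (i : Fin 3) {y : E3}
  (hy : y ∈ Ω)

include hΩ hF hH hy

theorem pdMat_add : pdMat i (fun x => F x + H x) y = pdMat i F y + pdMat i H y := by
  ext a b
  exact pd_add hΩ (hF a b) (hH a b) i hy

theorem pdMat_sub : pdMat i (fun x => F x - H x) y = pdMat i F y - pdMat i H y := by
  ext a b
  exact pd_sub hΩ (hF a b) (hH a b) i hy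

theorem pdMat_mul : pdMat i (fun x => F x * H x) y = pdMat i F y * H y + F y * pdMat i H y := by
  ext a b
  simp only [Matrix.add_apply, Matrix.mul_apply, pdMat_apply]
  rw [pd_sum hΩ _ (fun c _ => (hF a c).mul (hH c b)) i hy, ← Finset.sum_add_distrib]
  exact Finset.sum_congr rfl fun c _ => pd_mul hΩ (hF a c) (hH c b) i hy

end matrices

/-! ### Levi-Civita connection and curvature in a coordinate domain -/

/-- Components of a smooth complex metric on an open coordinate domain. -/
structure SmoothMetricOn (Ω : Set E3) (G : E3 → Matrix (Fin 3) (Fin 3) ℂ) : Prop where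
  isOpen : IsOpen Ω
  smooth : SmoothMat Ω G
  symm : ∀ x ∈ Ω, (G x).transpose = G x
  det_ne : ∀ x ∈ Ω, (G x).det ≠ 0

/-- The connection matrix `(Γ_a)^c_d`. -/
noncomputable def connMat (G : E3 → Matrix (Fin 3) (Fin 3) ℂ) (a : Fin 3) (y : E3) :
    Matrix (Fin 3) (Fin 3) ℂ :=
  Matrix.of fun c d => christoffel G c a d y

/-- The curvature matrix `(R_{ab})^c_d`. -/
noncomputable def curvMat (G : E3 → Matrix (Fin 3) (Fin 3) ℂ) (a b : Fin 3) (y : E3) :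
    Matrix (Fin 3) (Fin 3) ℂ :=
  Matrix.of fun c d => riemann G a b d c y

/-- The form ∂Γ - ∂Γ + [Γ, Γ] reduces skewness and the second Bianchi identity to noncommutative
ring arithmetic and commuting partial derivatives. -/
theorem curvMat_eq (G : E3 → Matrix (Fin 3) (Fin 3) ℂ) (a b : Fin 3) (y : E3) :
    curvMat G a b y = pdMat a (connMat G b) y - pdMat b (connMat G a) y
      + (connMat G a y * connMat G b y - connMat G b y * connMat G a y) := by
  ext c d
  simp only [Matrix.add_apply, Matrix.sub_apply, Matrix.mul_apply, ← Finset.sum_sub_distrib]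
  rfl

theorem curvMat_swap (G : E3 → Matrix (Fin 3) (Fin 3) ℂ) (a b : Fin 3) (y : E3) : curvMat G b a y = - curvMat G a b y := by
  rw [curvMat_eq, curvMat_eq]
  abel

theorem covDeriv₂_eq (G : E3 → Matrix (Fin 3) (Fin 3) ℂ) (T : Fin 3 → Fin 3 → E3 → ℂ) (e a b : Fin 3) (y : E3) :
    covDeriv₂ G T e a b y = (pdMat e (fun x => Matrix.of fun i j => T i j x) y
      - ((connMat G e y).transpose * Matrix.of (fun i j => T i j y)
        + Matrix.of (fun i j => T i j y) * connMat G e y)) a b := by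
  simp only [covDeriv₂, Finset.sum_add_distrib, Matrix.sub_apply, Matrix.add_apply,
    Matrix.mul_apply, Matrix.transpose_apply, Matrix.of_apply, connMat, pdMat_apply]
  simp only [mul_comm (T a _ y)]

namespace SmoothMetricOn

variable {Ω : Set E3} {G : E3 → Matrix (Fin 3) (Fin 3) ℂ} (h : SmoothMetricOn Ω G)
include h

theorem apply_comm {y : E3} (hy : y ∈ Ω) (a b : Fin 3) : G y a b = G y b a :=
  congrFun (congrFun (h.symm y hy) b) a

theorem pd_apply_comm {y : E3} (hy : y ∈ Ω) (c a b : Fin 3) :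
    pd c (fun x => G x a b) y = pd c (fun x => G x b a) y :=
  pd_congr h.isOpen (fun _ hx => h.apply_comm hx a b) c hy

theorem inv_mul {y : E3} (hy : y ∈ Ω) : (G y)⁻¹ * G y = 1 :=
  Matrix.nonsing_inv_mul _ (h.det_ne y hy).isUnit

theorem mul_inv {y : E3} (hy : y ∈ Ω) : G y * (G y)⁻¹ = 1 :=
  Matrix.mul_nonsing_inv _ (h.det_ne y hy).isUnit

theorem inv_transpose {y : E3} (hy : y ∈ Ω) : ((G y)⁻¹).transpose = (G y)⁻¹ := by
  rw [Matrix.transpose_nonsing_inv, h.symm y hy]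

theorem christoffel_comm {y : E3} (hy : y ∈ Ω) (c a b : Fin 3) :
    christoffel G c a b y = christoffel G c b a y := by
  unfold christoffel
  congr 1
  refine Finset.sum_congr rfl fun d _ => ?_
  rw [h.pd_apply_comm hy d a b]
  ring

theorem smooth_christoffel (c a b : Fin 3) : ContDiffOn ℝ ∞ (christoffel G c a b) Ω := by
  unfold christoffel
  refine contDiffOn_const.mul (ContDiffOn.sum fun d _ => ?_)
  exact (h.smooth.inv h.det_ne c d).mul
    (((smooth_pd h.isOpen (h.smooth _ _) _).add (smooth_pd h.isOpen (h.smooth _ _) _)).sub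
      (smooth_pd h.isOpen (h.smooth _ _) _))

theorem smooth_connMat (a : Fin 3) : SmoothMat Ω (connMat G a) :=
  fun c d => h.smooth_christoffel c a d

theorem smooth_riemann (a b d c : Fin 3) : ContDiffOn ℝ ∞ (riemann G a b d c) Ω := by
  unfold riemann
  refine ((smooth_pd h.isOpen (h.smooth_christoffel _ _ _) _).sub
    (smooth_pd h.isOpen (h.smooth_christoffel _ _ _) _)).add (ContDiffOn.sum fun e _ => ?_)
  exact ((h.smooth_christoffel _ _ _).mul (h.smooth_christoffel _ _ _)).sub
    ((h.smooth_christoffel _ _ _).mul (h.smooth_christoffel _ _ _))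

theorem smooth_curvMat (a b : Fin 3) : SmoothMat Ω (curvMat G a b) :=
  fun c d => h.smooth_riemann a b d c

theorem smooth_ricci (a b : Fin 3) : ContDiffOn ℝ ∞ (ricci G a b) Ω := by
  unfold ricci
  exact ContDiffOn.sum fun c _ => h.smooth_riemann _ _ _ _

theorem smooth_scalarR : ContDiffOn ℝ ∞ (scalarR G) Ω := by
  unfold scalarR
  exact ContDiffOn.sum fun a _ => ContDiffOn.sum fun b _ =>
    (h.smooth.inv h.det_ne a b).mul (h.smooth_ricci a b)

theorem smooth_scalarS : ContDiffOn ℝ ∞ (scalarS G) Ω := by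
  unfold scalarS
  exact h.smooth_scalarR.div_const _

theorem smooth_tfRicci (a b : Fin 3) : ContDiffOn ℝ ∞ (tfRicci G a b) Ω := by
  unfold tfRicci
  exact (h.smooth_ricci a b).sub ((contDiffOn_const.mul h.smooth_scalarR).mul (h.smooth a b))

/-- The Levi-Civita connection is metric. -/
theorem pdMat_metric (a : Fin 3) {y : E3} (hy : y ∈ Ω) :
    pdMat a G y = G y * connMat G a y + (connMat G a y).transpose * G y := by
  -- Lowering the upper index cancels the inverse metric and leaves Christoffel symbols of the first
  -- kind; such a symbol plus its transpose is ∂_a g_bc.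
  have key : ∀ b c, (G y * connMat G a y) b c =
      (1 / 2) * (pd a (fun x => G x c b) y + pd c (fun x => G x a b) y
        - pd b (fun x => G x a c) y) := by
    intro b c
    set v : Fin 3 → ℂ := fun d => pd a (fun x => G x c d) y + pd c (fun x => G x a d) y
        - pd d (fun x => G x a c) y with hv
    have h1 : ∀ e, connMat G a y e c = (1 / 2) * ((G y)⁻¹.mulVec v) e := fun e => rfl
    have h2 : (G y * connMat G a y) b c = (1 / 2) * (G y).mulVec ((G y)⁻¹.mulVec v) b := by
      simp only [Matrix.mul_apply, h1, Matrix.mulVec, dotProduct, Finset.mul_sum]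
      refine Finset.sum_congr rfl fun e _ => Finset.sum_congr rfl fun d _ => by ring
    rw [h2, Matrix.mulVec_mulVec, h.mul_inv hy, Matrix.one_mulVec]
  have hT : (connMat G a y).transpose * G y = (G y * connMat G a y).transpose := by
    rw [Matrix.transpose_mul, h.symm y hy]
  ext b c
  rw [hT, Matrix.add_apply, Matrix.transpose_apply, key, key, pdMat_apply,
    h.pd_apply_comm hy a c b]
  ring

/-- Differentiate G⁻¹G = 1 and cancel G: the inverse metric is parallel too. -/
theorem pdMat_inv (a : Fin 3) {y : E3} (hy : y ∈ Ω) :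
    pdMat a (fun x => (G x)⁻¹) y =
      - (connMat G a y * (G y)⁻¹) - (G y)⁻¹ * (connMat G a y).transpose := by
  have h0 : pdMat a (fun x => (G x)⁻¹ * G x) y = 0 := by
    rw [pdMat_congr h.isOpen (fun x hx => h.inv_mul hx) a hy, pdMat_const]
  rw [pdMat_mul h.isOpen (h.smooth.inv h.det_ne) h.smooth a hy, h.pdMat_metric a hy] at h0
  have h1 := congrArg (· * (G y)⁻¹) h0
  simp only [add_mul, mul_add, zero_mul, ← mul_assoc, h.inv_mul hy] at h1
  simp only [mul_assoc, h.mul_inv hy, one_mul, mul_one] at h1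
  rw [eq_neg_of_add_eq_zero_left h1]
  abel

/-- Differentiating metric compatibility twice, the commutator of second partials of G, which is
zero, is the left-hand side. -/
theorem curvMat_skew (a b : Fin 3) {y : E3} (hy : y ∈ Ω) :
    G y * curvMat G a b y + (curvMat G a b y).transpose * G y = 0 := by
  have second : ∀ i j, pdMat i (pdMat j G) y =
      (G y * connMat G i y + (connMat G i y).transpose * G y) * connMat G j y
        + G y * pdMat i (connMat G j) y
        + ((pdMat i (connMat G j) y).transpose * G y
        + (connMat G j y).transpose *
          (G y * connMat G i y + (connMat G i y).transpose * G y)) := by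
    intro i j
    rw [pdMat_congr h.isOpen (fun x hx => h.pdMat_metric j hx) i hy,
      pdMat_add h.isOpen (h.smooth.mul (h.smooth_connMat j))
        ((h.smooth_connMat j).transpose.mul h.smooth) i hy,
      pdMat_mul h.isOpen h.smooth (h.smooth_connMat j) i hy,
      pdMat_mul h.isOpen (h.smooth_connMat j).transpose h.smooth i hy,
      h.pdMat_metric i hy, pdMat_transpose]
  have hc := pdMat_comm h.isOpen h.smooth a b hy
  rw [second, second] at hc
  rw [← sub_eq_zero] at hc
  rw [curvMat_eq, ← hc]
  simp only [Matrix.transpose_add, Matrix.transpose_sub, Matrix.transpose_mul]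
  noncomm_ring

/-- Vanishing torsion: symmetry of Γ in its lower indices makes all terms cancel in pairs. -/
theorem first_bianchi (a b c d : Fin 3) {y : E3} (hy : y ∈ Ω) :
    curvMat G a b y d c + curvMat G b c y d a + curvMat G c a y d b = 0 := by
  have hp : ∀ i j k l, pd i (christoffel G j k l) y = pd i (christoffel G j l k) y :=
    fun i j k l => pd_congr h.isOpen (fun x hx => h.christoffel_comm hx j k l) i hy
  simp only [curvMat, Matrix.of_apply, riemann, Finset.sum_sub_distrib]
  rw [hp a d b c, hp b d a c, hp c d b a]
  simp only [h.christoffel_comm hy _ b c, h.christoffel_comm hy _ a c, h.christoffel_comm hy _ b a]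
  ring

/-- Tracing the first Bianchi identity shows that the antisymmetric part of Ricci is a trace of the
curvature matrix, which is zero because that matrix is skew for the metric. -/
theorem ricci_comm (a b : Fin 3) {y : E3} (hy : y ∈ Ω) : ricci G a b y = ricci G b a y := by
  have htr : (curvMat G b a y).trace = 0 := by
    have h1 := congrArg (fun A => ((G y)⁻¹ * A).trace) (h.curvMat_skew b a hy)
    simp only [mul_add, Matrix.trace_add, ← mul_assoc, h.inv_mul hy, one_mul, mul_zero,
      Matrix.trace_zero] at h1
    rw [mul_assoc, Matrix.trace_mul_comm, mul_assoc, h.mul_inv hy, mul_one,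
      Matrix.trace_transpose] at h1
    linear_combination h1 / 2
  have hs : ∀ c, riemann G a c b c y - riemann G b c a c y + curvMat G b a y c c = 0 := by
    intro c
    have h1 := h.first_bianchi a c b c hy
    have h2 := congrFun (congrFun (curvMat_swap G b c y) c) a
    simp only [Matrix.neg_apply] at h2
    rw [h2] at h1
    simp only [curvMat, Matrix.of_apply] at h1 ⊢
    linear_combination h1
  have := Finset.sum_congr rfl fun c (_ : c ∈ Finset.univ) => hs c
  simp only [Finset.sum_add_distrib, Finset.sum_sub_distrib, Finset.sum_const_zero] at this
  rw [Matrix.trace] at htr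
  simp only [Matrix.diag_apply] at htr
  rw [htr, add_zero] at this
  exact sub_eq_zero.1 this

end SmoothMetricOn

/-- The derivative `∇_c (R_{ab})^·_·` in which the indices `a`, `b` are not corrected. -/
noncomputable def gaugeDerivCurv (G : E3 → Matrix (Fin 3) (Fin 3) ℂ) (c a b : Fin 3) (y : E3) :
    Matrix (Fin 3) (Fin 3) ℂ :=
  pdMat c (curvMat G a b) y + (connMat G c y * curvMat G a b y - curvMat G a b y * connMat G c y)

/-- The covariant derivative `∇_c R_{abd}{}^e` as a matrix in the indices `e`, `d`. -/
noncomputable def covDerivCurv (G : E3 → Matrix (Fin 3) (Fin 3) ℂ) (c a b : Fin 3) (y : E3) :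
    Matrix (Fin 3) (Fin 3) ℂ :=
  gaugeDerivCurv G c a b y - ∑ f, (christoffel G f c a y • curvMat G f b y
    + christoffel G f c b y • curvMat G a f y)

theorem covDerivCurv_swap (G : E3 → Matrix (Fin 3) (Fin 3) ℂ) (c a b : Fin 3) (y : E3) :
    covDerivCurv G c b a y = - covDerivCurv G c a b y := by
  have h1 : pdMat c (curvMat G b a) y = - pdMat c (curvMat G a b) y := by
    have : curvMat G b a = fun x => - curvMat G a b x := funext fun x => curvMat_swap G a b x
    rw [this]
    ext i j
    exact pd_neg _ _ _
  unfold covDerivCurv gaugeDerivCurv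
  rw [h1, curvMat_swap G a b]
  simp only [curvMat_swap G _ a, curvMat_swap G b, Finset.sum_add_distrib, smul_neg,
    Finset.sum_neg_distrib]
  rw [show ∀ f, curvMat G b f y = - curvMat G f b y from fun f => curvMat_swap G f b y]
  noncomm_ring

/-! ### Symmetries of ∇R and the Bianchi identities -/

namespace SmoothMetricOn

variable {Ω : Set E3} {G : E3 → Matrix (Fin 3) (Fin 3) ℂ} (h : SmoothMetricOn Ω G)
include h

/-- Differentiate `curvMat_skew`. The terms in Γ left over are that same identity multiplied by Γ on
the right and by its transpose on the left. -/
theorem gaugeDerivCurv_skew (c a b : Fin 3) {y : E3} (hy : y ∈ Ω) :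
    G y * gaugeDerivCurv G c a b y + (gaugeDerivCurv G c a b y).transpose * G y = 0 := by
  have h0 : pdMat c (fun x => G x * curvMat G a b x + (curvMat G a b x).transpose * G x) y = 0 := by
    rw [pdMat_congr h.isOpen (fun x hx => h.curvMat_skew a b hx) c hy, pdMat_const]
  have hF := h.smooth_curvMat a b
  rw [pdMat_add h.isOpen (h.smooth.mul hF) (hF.transpose.mul h.smooth) c hy,
    pdMat_mul h.isOpen h.smooth hF c hy, pdMat_mul h.isOpen hF.transpose h.smooth c hy,
    h.pdMat_metric c hy, pdMat_transpose] at h0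
  have hs := h.curvMat_skew a b hy
  have h1 := congrArg (fun A => A * connMat G c y) hs
  have h2 := congrArg (fun A => (connMat G c y).transpose * A) hs
  simp only [zero_mul, mul_zero] at h1 h2
  rw [← sub_eq_zero.2 (h0.trans h1.symm), ← sub_zero (_ - _), ← h2]
  simp only [gaugeDerivCurv, Matrix.transpose_add, Matrix.transpose_sub, Matrix.transpose_mul]
  noncomm_ring

theorem covDerivCurv_skew (c a b : Fin 3) {y : E3} (hy : y ∈ Ω) :
    G y * covDerivCurv G c a b y + (covDerivCurv G c a b y).transpose * G y = 0 := by
  have h1 := h.gaugeDerivCurv_skew c a b hy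
  have h2 : ∀ f, G y * (christoffel G f c a y • curvMat G f b y
      + christoffel G f c b y • curvMat G a f y)
      + (christoffel G f c a y • curvMat G f b y
      + christoffel G f c b y • curvMat G a f y).transpose * G y = 0 := by
    intro f
    have e1 := congrArg (christoffel G f c a y • ·) (h.curvMat_skew f b hy)
    have e2 := congrArg (christoffel G f c b y • ·) (h.curvMat_skew a f hy)
    simp only [smul_zero, smul_add] at e1 e2
    simp only [Matrix.transpose_add, Matrix.transpose_smul, mul_add, add_mul, Matrix.mul_smul,
      Matrix.smul_mul]
    rw [← add_zero (0 : Matrix (Fin 3) (Fin 3) ℂ)]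
    nth_rewrite 1 [← e1]
    rw [← e2]
    abel
  have h3 := Finset.sum_congr rfl fun f (_ : f ∈ Finset.univ) => h2 f
  rw [Finset.sum_add_distrib, ← Finset.mul_sum, ← Finset.sum_mul, ← Matrix.transpose_sum,
    Finset.sum_const_zero] at h3
  rw [covDerivCurv, Matrix.transpose_sub, mul_sub, sub_mul, ← sub_zero (0 : Matrix _ _ ℂ)]
  nth_rewrite 1 [← h1]
  rw [← h3]
  abel

/-- The cyclic sum of ∂F + [Γ, F] vanishes by commuting partials and the Jacobi identity; the
Christoffel corrections of the form indices cancel by vanishing torsion and antisymmetry of the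
curvature. -/
theorem second_bianchi (a b c : Fin 3) {y : E3} (hy : y ∈ Ω) :
    covDerivCurv G a b c y + covDerivCurv G b c a y + covDerivCurv G c a b y = 0 := by
  have hd : ∀ i j k, gaugeDerivCurv G i j k y =
      pdMat i (pdMat j (connMat G k)) y - pdMat i (pdMat k (connMat G j)) y
      + (pdMat i (connMat G j) y * connMat G k y + connMat G j y * pdMat i (connMat G k) y
        - (pdMat i (connMat G k) y * connMat G j y + connMat G k y * pdMat i (connMat G j) y))
      + (connMat G i y * (pdMat j (connMat G k) y - pdMat k (connMat G j) y
          + (connMat G j y * connMat G k y - connMat G k y * connMat G j y))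
        - (pdMat j (connMat G k) y - pdMat k (connMat G j) y
          + (connMat G j y * connMat G k y - connMat G k y * connMat G j y)) * connMat G i y) := by
    intro i j k
    have sj := h.smooth_connMat j
    have sk := h.smooth_connMat k
    rw [gaugeDerivCurv, pdMat_congr h.isOpen (fun x _ => curvMat_eq G j k x) i hy,
      pdMat_add h.isOpen ((sk.pdMat h.isOpen j).sub (sj.pdMat h.isOpen k))
        ((sj.mul sk).sub (sk.mul sj)) i hy,
      pdMat_sub h.isOpen (sk.pdMat h.isOpen j) (sj.pdMat h.isOpen k) i hy,
      pdMat_sub h.isOpen (sj.mul sk) (sk.mul sj) i hy,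
      pdMat_mul h.isOpen sj sk i hy, pdMat_mul h.isOpen sk sj i hy, curvMat_eq G j k y]
  have hgauge : gaugeDerivCurv G a b c y + gaugeDerivCurv G b c a y + gaugeDerivCurv G c a b y
      = 0 := by
    rw [hd, hd, hd, pdMat_comm h.isOpen (h.smooth_connMat c) a b hy,
      pdMat_comm h.isOpen (h.smooth_connMat a) b c hy,
      pdMat_comm h.isOpen (h.smooth_connMat b) a c hy]
    noncomm_ring
  have hcorr : ∑ f, (christoffel G f a b y • curvMat G f c y
        + christoffel G f a c y • curvMat G b f y)
      + ∑ f, (christoffel G f b c y • curvMat G f a y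
        + christoffel G f b a y • curvMat G c f y)
      + ∑ f, (christoffel G f c a y • curvMat G f b y
        + christoffel G f c b y • curvMat G a f y) = 0 := by
    rw [← Finset.sum_add_distrib, ← Finset.sum_add_distrib]
    refine Finset.sum_eq_zero fun f _ => ?_
    rw [h.christoffel_comm hy f b a, h.christoffel_comm hy f c a, h.christoffel_comm hy f c b,
      curvMat_swap G f b, curvMat_swap G f c, curvMat_swap G f a]
    simp only [smul_neg]
    abel
  unfold covDerivCurv
  rw [← sub_zero (0 : Matrix (Fin 3) (Fin 3) ℂ)]
  nth_rewrite 1 [← hgauge]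
  rw [← hcorr]
  abel

/-! ### Covariant derivatives of covariant two-tensors -/

/-- Contraction commutes with ∇: the upper and lower corrections of the contracted index cancel once
the double sums are interchanged. -/
theorem covDeriv₂_ricci (e a b : Fin 3) {y : E3} (hy : y ∈ Ω) :
    covDeriv₂ G (ricci G) e a b y = ∑ c, covDerivCurv G e a c y c b := by
  have hpd : pd e (ricci G a b) y = ∑ c, pd e (riemann G a c b c) y := by
    change pd e (fun x => ∑ c, riemann G a c b c x) y = _
    exact pd_sum h.isOpen _ (fun c _ => h.smooth_riemann a c b c) e hy
  have hpm : ∀ c, pdMat e (curvMat G a c) y c b = pd e (riemann G a c b c) y := fun c => rfl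
  simp only [covDeriv₂, covDerivCurv, gaugeDerivCurv, Matrix.sub_apply, Matrix.add_apply,
    Matrix.mul_apply, Matrix.sum_apply, Matrix.smul_apply, smul_eq_mul, hpd, hpm,
    Finset.sum_add_distrib, Finset.sum_sub_distrib, connMat, curvMat, Matrix.of_apply, ricci,
    Finset.mul_sum]
  rw [Finset.sum_comm (f := fun c f => christoffel G f e a y * riemann G f c b c y),
    Finset.sum_comm (f := fun c f => christoffel G f e c y * riemann G a f b c y),
    Finset.sum_comm (f := fun c f => riemann G a c f c y * christoffel G f e b y)]
  simp only [mul_comm (riemann G a _ _ _ y)]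
  ring

theorem covDeriv₂_metric (e a b : Fin 3) {y : E3} (hy : y ∈ Ω) :
    covDeriv₂ G (fun i j x => G x i j) e a b y = 0 := by
  rw [covDeriv₂_eq]
  change (pdMat e G y - ((connMat G e y).transpose * G y + G y * connMat G e y)) a b = 0
  rw [h.pdMat_metric e hy]
  simp [add_comm]

/-- The metric trace commutes with covariant differentiation. -/
theorem pd_trace {T : Fin 3 → Fin 3 → E3 → ℂ} (hT : ∀ a b, ContDiffOn ℝ ∞ (T a b) Ω)
    (e : Fin 3) {y : E3} (hy : y ∈ Ω) :
    pd e (fun x => ∑ a, ∑ b, (G x)⁻¹ a b * T a b x) y =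
      ∑ a, ∑ b, (G y)⁻¹ a b * covDeriv₂ G T e a b y := by
  set TM : E3 → Matrix (Fin 3) (Fin 3) ℂ := fun x => Matrix.of fun i j => T i j x with hTM
  have hsT : SmoothMat Ω TM := fun a b => hT a b
  have tr : ∀ (A B : Matrix (Fin 3) (Fin 3) ℂ), ∑ a, ∑ b, A a b * B a b =
      (A * B.transpose).trace := by
    intro A B
    simp [Matrix.trace, Matrix.mul_apply]
  have h1 : ∑ a, ∑ b, (G y)⁻¹ a b * covDeriv₂ G T e a b y =
      ((G y)⁻¹ * (pdMat e TM y - ((connMat G e y).transpose * TM y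
        + TM y * connMat G e y)).transpose).trace := by
    rw [← tr]
    refine Finset.sum_congr rfl fun a _ => Finset.sum_congr rfl fun b _ => ?_
    rw [covDeriv₂_eq]
  have hprod := (h.smooth.inv h.det_ne).mul hsT.transpose
  have h2 : pd e (fun x => ∑ a, ∑ b, (G x)⁻¹ a b * T a b x) y =
      (pdMat e (fun x => (G x)⁻¹ * (TM x).transpose) y).trace := by
    have : (fun x => ∑ a, ∑ b, (G x)⁻¹ a b * T a b x) =
        fun x => ∑ a, ((G x)⁻¹ * (TM x).transpose) a a := by
      funext x
      exact tr ((G x)⁻¹) (TM x)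
    rw [this, pd_sum h.isOpen _ (fun a _ => hprod a a) e hy]
    rfl
  rw [h1, h2, pdMat_mul h.isOpen (h.smooth.inv h.det_ne) hsT.transpose e hy, h.pdMat_inv e hy,
    pdMat_transpose]
  simp only [Matrix.transpose_sub, Matrix.transpose_add, Matrix.transpose_mul,
    Matrix.transpose_transpose, mul_sub, sub_mul, mul_add, Matrix.trace_add, Matrix.trace_sub,
    neg_mul, Matrix.trace_neg]
  -- Cyclicity of the trace matches the terms of ∂G⁻¹ with the Christoffel terms of ∇T.
  rw [mul_assoc (connMat G e y), Matrix.trace_mul_comm (connMat G e y), ← mul_assoc, mul_assoc,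
    mul_assoc]
  ring

/-- The contracted second Bianchi identity `2 ∇^c R_{ec} = ∇_e R`. -/
theorem contracted_bianchi (e : Fin 3) {y : E3} (hy : y ∈ Ω) :
    2 * ∑ c, ∑ d, (G y)⁻¹ c d * covDeriv₂ G (ricci G) c e d y = pd e (scalarR G) y := by
  have h0 : pd e (scalarR G) y = ∑ a, ∑ d, (G y)⁻¹ a d * covDeriv₂ G (ricci G) e a d y :=
    h.pd_trace h.smooth_ricci e hy
  have hH : ∀ a b, (G y)⁻¹ a b = (G y)⁻¹ b a := fun a b =>
    congrFun (congrFun (h.inv_transpose hy) b) a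
  -- With its lower matrix index raised, ∇R is antisymmetric in the matrix indices.
  have hskew : ∀ a b c i j, (covDerivCurv G a b c y * (G y)⁻¹) i j =
      - (covDerivCurv G a b c y * (G y)⁻¹) j i := by
    intro a b c i j
    set D := covDerivCurv G a b c y with hD
    have h1 := congrArg (fun A => (G y)⁻¹ * A * (G y)⁻¹) (h.covDerivCurv_skew a b c hy)
    simp only [mul_add, add_mul, mul_zero, zero_mul] at h1
    rw [← mul_assoc, h.inv_mul hy, one_mul, mul_assoc, mul_assoc, h.mul_inv hy, mul_one] at h1
    have h2 : (G y)⁻¹ * D.transpose = (D * (G y)⁻¹).transpose := by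
      rw [Matrix.transpose_mul, h.inv_transpose hy]
    rw [h2] at h1
    have := congrFun (congrFun h1 i) j
    simp only [Matrix.add_apply, Matrix.transpose_apply, Matrix.zero_apply] at this
    exact eq_neg_of_add_eq_zero_left this
  -- The second Bianchi identity contracted twice. The first term is ∇_e R; the other two are each
  -- minus the divergence of Ricci, by antisymmetry in the form indices (`t2`) and in the matrix
  -- indices (`t3`).
  have hB : ∑ a, ∑ d, ∑ c, (G y)⁻¹ a d * (covDerivCurv G e a c y c d
      + covDerivCurv G a c e y c d + covDerivCurv G c e a y c d) = 0 := by
    refine Finset.sum_eq_zero fun a _ => Finset.sum_eq_zero fun d _ =>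
      Finset.sum_eq_zero fun c _ => ?_
    have := congrFun (congrFun (h.second_bianchi e a c hy) c) d
    simp only [Matrix.add_apply, Matrix.zero_apply] at this
    rw [this, mul_zero]
  simp only [mul_add, Finset.sum_add_distrib] at hB
  have t1 : ∑ a, ∑ d, ∑ c, (G y)⁻¹ a d * covDerivCurv G e a c y c d = pd e (scalarR G) y := by
    rw [h0]
    simp only [h.covDeriv₂_ricci _ _ _ hy, Finset.mul_sum]
  have t2 : ∑ a, ∑ d, ∑ c, (G y)⁻¹ a d * covDerivCurv G a c e y c d =
      - ∑ c, ∑ d, (G y)⁻¹ c d * covDeriv₂ G (ricci G) c e d y := by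
    simp only [h.covDeriv₂_ricci _ _ _ hy, Finset.mul_sum, ← Finset.sum_neg_distrib]
    refine Finset.sum_congr rfl fun a _ => Finset.sum_congr rfl fun d _ =>
      Finset.sum_congr rfl fun c _ => ?_
    rw [covDerivCurv_swap G a e c]
    simp
  have t3 : ∑ a, ∑ d, ∑ c, (G y)⁻¹ a d * covDerivCurv G c e a y c d =
      - ∑ c, ∑ d, (G y)⁻¹ c d * covDeriv₂ G (ricci G) c e d y := by
    have l1 : ∑ a, ∑ d, ∑ c, (G y)⁻¹ a d * covDerivCurv G c e a y c d =
        ∑ a, ∑ c, (covDerivCurv G c e a y * (G y)⁻¹) c a := by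
      refine Finset.sum_congr rfl fun a _ => ?_
      rw [Finset.sum_comm]
      refine Finset.sum_congr rfl fun c _ => ?_
      rw [Matrix.mul_apply]
      exact Finset.sum_congr rfl fun d _ => by rw [hH a d, mul_comm]
    have l2 : ∑ c, ∑ d, (G y)⁻¹ c d * covDeriv₂ G (ricci G) c e d y =
        ∑ a, ∑ c, (covDerivCurv G c e a y * (G y)⁻¹) a c := by
      simp only [h.covDeriv₂_ricci _ _ _ hy, Finset.mul_sum, Matrix.mul_apply]
      rw [Finset.sum_comm (f := fun a c => ∑ d, covDerivCurv G c e a y a d * (G y)⁻¹ d c)]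
      refine Finset.sum_congr rfl fun c _ => ?_
      rw [Finset.sum_comm]
      exact Finset.sum_congr rfl fun d _ => Finset.sum_congr rfl fun a _ => by
        rw [hH c a, mul_comm]
    rw [l1, l2]
    simp only [← Finset.sum_neg_distrib]
    exact Finset.sum_congr rfl fun a _ => Finset.sum_congr rfl fun c _ => hskew _ _ _ _ _
  rw [t1, t2, t3] at hB
  linear_combination -hB

end SmoothMetricOn

/-! ### Null frames and type N symmetric forms -/

/-- A frame with `B = 2 k ⊙ ℓ - 2 n ⊗ n` for a bilinear form `B`. -/
structure NullTriple {V : Type*} [AddCommGroup V] [Module ℂ V] (B : LinearMap.BilinForm ℂ V)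
    (k l n : V) : Prop where
  kk : B k k = 0
  ll : B l l = 0
  nn : B n n = -1 / 2
  kl : B k l = 1
  lk : B l k = 1
  kn : B k n = 0
  nk : B n k = 0
  ln : B l n = 0
  nl : B n l = 0

section algebra

variable {V : Type*} [AddCommGroup V] [Module ℂ V] {B Q : LinearMap.BilinForm ℂ V} {k l n : V}

/-- The null rotation taking `k` to the null vector `s² k + 2 s t n + t² ℓ`. -/
theorem NullTriple.rotate (hf : NullTriple B k l n) {s t u v : ℂ} (huv : s * v - t * u = 1) :
    NullTriple B (s ^ 2 • k + (2 * s * t) • n + t ^ 2 • l)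
      (u ^ 2 • k + (2 * u * v) • n + v ^ 2 • l)
      ((s * u) • k + (s * v + t * u) • n + (t * v) • l) := by
  constructor <;>
  simp only [map_add, map_smul, LinearMap.add_apply, LinearMap.smul_apply, smul_eq_mul, hf.kk,
    hf.ll, hf.nn, hf.kl, hf.lk, hf.kn, hf.nk, hf.ln, hf.nl]
  · ring
  · ring
  -- The nonzero products are multiples of D² with D = s v - t u, and D² - 1 = (D + 1)(D - 1).
  · linear_combination (-1 / 2) * (s * v - t * u + 1) * huv
  · linear_combination (s * v - t * u + 1) * huv
  · linear_combination (s * v - t * u + 1) * huv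
  all_goals ring

/-- A trace-free symmetric form whose quartic is the fourth power of a nonzero linear form is
twice the square of the covector of a null vector, in an adapted null frame. -/
theorem NullTriple.exists_adapted (hf : NullTriple B k l n)
    (hspan : ∀ v, v = B l v • k + B k v • l - (2 * B n v) • n)
    (hQ : ∀ v w, Q v w = Q w v) (htr : Q k l + Q l k - 2 * Q n n = 0)
    {α β : ℂ} (hne : (α, β) ≠ (0, 0))
    (hquart : ∀ s t : ℂ, Q (s ^ 2 • k + (2 * s * t) • n + t ^ 2 • l)
      (s ^ 2 • k + (2 * s * t) • n + t ^ 2 • l) / 2 = (α * s + β * t) ^ 4) :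
    ∃ K L n', NullTriple B K L n' ∧ ∀ v w, Q v w = 2 * (B K v * B K w) := by
  -- The root of the quartic is [s : t] = [β : -α]; it is completed to a matrix of determinant one.
  obtain ⟨u, v, huv⟩ : ∃ u v : ℂ, β * v - (-α) * u = 1 := by
    by_cases hα : α = 0
    · have hβ : β ≠ 0 := fun hβ => hne (by rw [hα, hβ])
      exact ⟨0, β⁻¹, by simp [hβ]⟩
    · exact ⟨α⁻¹, 0, by simp [hα]⟩
  refine ⟨_, _, _, hf.rotate huv, ?_⟩
  simp only [map_add, map_smul, LinearMap.add_apply, LinearMap.smul_apply, smul_eq_mul, hQ l k,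
    hQ n k, hQ l n] at hquart
  -- Five values determine the five coefficients of the quartic. Its middle coefficient only gives a
  -- combination of Q(k, l) and Q(n, n); the trace condition separates them.
  have e1 := hquart 1 0
  have e2 := hquart 0 1
  have e3 := hquart 1 1
  have e4 := hquart 1 (-1)
  have e5 := hquart 1 2
  rw [hQ l k] at htr
  have qkk : Q k k = 2 * α ^ 4 := by linear_combination 2 * e1
  have qll : Q l l = 2 * β ^ 4 := by linear_combination 2 * e2
  have qnl : Q n l = 2 * α * β ^ 3 := by
    linear_combination (1 / 24 : ℂ) * (2 * e5 - 2 * e1 - 32 * e2) -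
      (1 / 6 : ℂ) * (e3 + e4 - 2 * e1 - 2 * e2) - (1 / 12 : ℂ) * (e3 - e4)
  have qkn : Q k n = 2 * α ^ 3 * β := by
    linear_combination (1 / 4 : ℂ) * (e3 - e4) - qnl
  have qsum : 2 * Q k l + 4 * Q n n = 12 * α ^ 2 * β ^ 2 := by
    linear_combination e3 + e4 - 2 * e1 - 2 * e2
  have qnn : Q n n = 2 * α ^ 2 * β ^ 2 := by linear_combination (qsum - htr) / 6
  have qkl : Q k l = 2 * α ^ 2 * β ^ 2 := by linear_combination (htr + 2 * qnn) / 2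
  have qlk := (hQ l k).trans qkl
  have qnk := (hQ n k).trans qkn
  have qln := (hQ l n).trans qnl
  intro v w
  have hv : ∀ x, Q v x = B l v * Q k x + B k v * Q l x - 2 * B n v * Q n x := by
    intro x
    conv_lhs => rw [hspan v]
    simp
  have hw : ∀ x, Q x w = B l w * Q x k + B k w * Q x l - 2 * B n w * Q x n := by
    intro x
    conv_lhs => rw [hspan w]
    simp
  rw [hv, hw, hw, hw, qkk, qkl, qkn, qlk, qll, qln, qnk, qnl, qnn]
  simp only [map_add, map_smul, LinearMap.add_apply, LinearMap.smul_apply, smul_eq_mul]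
  ring

/-- The only null direction orthogonal to a null vector is its own. -/
theorem NullTriple.eq_smul_of_null (hf : NullTriple B k l n)
    (hspan : ∀ v, v = B l v • k + B k v • l - (2 * B n v) • n) {v : V} (hkv : B k v = 0)
    (hvv : B v v = 0) : v = B l v • k := by
  have hv := hspan v
  rw [hkv] at hv
  have hn : B n v = 0 := by
    -- On k^⊥ the component along k contributes nothing to B v v.
    have : B v v = -2 * (B n v) ^ 2 := by
      conv_lhs => rw [hv]
      simp only [map_add, map_sub, map_smul, LinearMap.add_apply, LinearMap.sub_apply,
        LinearMap.smul_apply, smul_eq_mul, hf.kk, hf.nn, hf.kn, hf.nk]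
      simp
      ring
    rw [hvv] at this
    exact pow_eq_zero_iff (two_ne_zero) |>.1 (by linear_combination (1 / 2 : ℂ) * this)
  rw [hn] at hv
  simpa using hv

end algebra

/-! ### Null frames in coordinates and the pointwise algebra -/

section matrices

open Matrix

variable {G : Matrix (Fin 3) (Fin 3) ℂ} {k l n : Fin 3 → ℂ}

/-- With k, l, n as the columns of P, the matrix J inverts the Gram matrix PᵀGP. A one-sided inverse
of a square matrix is two-sided, so the factors can be cycled to P J Pᵀ G = 1; no invertibility of G
is presupposed. -/
theorem NullTriple.mul_eq_one (hf : NullTriple (Matrix.toBilin' G) k l n) :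
    (vecMulVec k l + vecMulVec l k - (2 : ℂ) • vecMulVec n n) * G = 1 := by
  let P : Matrix (Fin 3) (Fin 3) ℂ := (Matrix.of ![k, l, n]).transpose
  let J : Matrix (Fin 3) (Fin 3) ℂ := !![0, 1, 0; 1, 0, 0; 0, 0, -2]
  have hent : ∀ i j, (P.transpose * G * P) i j =
      Matrix.toBilin' G (![k, l, n] i) (![k, l, n] j) := by
    intro i j
    rw [Matrix.toBilin'_apply', Matrix.mul_assoc]
    rfl
  have h1 : J * (P.transpose * G * P) = 1 := by
    have : P.transpose * G * P = !![0, 1, 0; 1, 0, 0; 0, 0, -1 / 2] := by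
      ext i j
      rw [hent]
      fin_cases i <;> fin_cases j <;>
        simp [hf.kk, hf.ll, hf.nn, hf.kl, hf.lk, hf.kn, hf.nk, hf.ln, hf.nl]
    rw [this]
    ext i j
    fin_cases i <;> fin_cases j <;> simp [J, Matrix.mul_apply, Fin.sum_univ_three]
    norm_num
  have h2 : P * (J * (P.transpose * G)) = 1 := by
    rw [mul_eq_one_comm]
    simpa only [Matrix.mul_assoc] using h1
  rw [← h2, ← Matrix.mul_assoc, ← Matrix.mul_assoc]
  congr 1
  ext i j
  simp [P, J, Matrix.mul_apply, Fin.sum_univ_three, vecMulVec_apply]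
  ring

theorem NullTriple.inv_eq (hf : NullTriple (Matrix.toBilin' G) k l n) :
    G⁻¹ = vecMulVec k l + vecMulVec l k - (2 : ℂ) • vecMulVec n n :=
  Matrix.inv_eq_left_inv hf.mul_eq_one

theorem NullTriple.expand (hf : NullTriple (Matrix.toBilin' G) k l n) (v : Fin 3 → ℂ) :
    v = Matrix.toBilin' G l v • k + Matrix.toBilin' G k v • l
      - (2 * Matrix.toBilin' G n v) • n := by
  conv_lhs => rw [← Matrix.one_mulVec v, ← hf.mul_eq_one]
  simp only [Matrix.toBilin'_apply', ← Matrix.mulVec_mulVec]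
  ext i
  simp [Matrix.mulVec, dotProduct, vecMulVec_apply, Fin.sum_univ_three]
  ring

/-- The pointwise algebra behind the theorem: `κ` is the covector of the null vector `k`, `W` its
covariant derivative, `T` that of a tensor proportional to `κ ⊗ κ`, and `S` a gradient. -/
theorem NullTriple.derivative_vanishes (hf : NullTriple (Matrix.toBilin' G) k l n)
    {κ q S : Fin 3 → ℂ} {W : Matrix (Fin 3) (Fin 3) ℂ} {T : Fin 3 → Fin 3 → Fin 3 → ℂ}
    (hκ : ∀ a, κ a = ∑ b, G a b * k b)
    (hG : ∀ a b, G a b = G b a)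
    (hT : ∀ c a b, T c a b = W c a * κ b + κ a * W c b - q c * (κ a * κ b))
    (hD : ∀ c, ∑ a, W c a * k a = 0)
    (hS : ∀ a b, κ a * S b - κ b * S a = 0)
    (hA : ∀ a b, ∑ c, k c * ((-T b c a - S b * G c a + T c b a + S c * G b a)
      - G c a * S b) = 0)
    (hB : ∀ b, ∑ c, ∑ a, G⁻¹ c a * T c b a = 2 * S b) {X Y : Fin 3 → ℂ}
    (hX : ∑ a, κ a * X a = 0) (hY : ∑ a, κ a * Y a = 0) :
    ∑ b, ∑ a, X b * Y a * W b a = 0 := by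
  have hdot : ∀ v, Matrix.toBilin' G k v = ∑ a, κ a * v a := by
    intro v
    rw [Matrix.toBilin'_apply]
    simp only [hκ, Fin.sum_univ_three, hG 1 0, hG 2 0, hG 2 1]
    ring
  have hk : ∑ a, κ a * k a = 0 := by rw [← hdot, hf.kk]
  have hl : ∑ a, κ a * l a = 1 := by rw [← hdot, hf.kl]
  have hn : ∑ a, κ a * n a = 0 := by rw [← hdot, hf.kn]
  -- Contract κ ∧ S = 0 with l, using κ(l) = 1.
  obtain ⟨σ, hσ⟩ : ∃ σ, ∀ b, S b = σ * κ b := by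
    refine ⟨∑ a, l a * S a, fun b => ?_⟩
    have h0 := hS 0 b
    have h1 := hS 1 b
    have h2 := hS 2 b
    simp only [Fin.sum_univ_three] at hl ⊢
    linear_combination (-S b) * hl + l 0 * h0 + l 1 * h1 + l 2 * h2
  set U : Fin 3 → ℂ := fun b => ∑ c, k c * W c b with hU
  set r := ∑ c, k c * q c with hr
  -- The Cotton condition contracted with k: `hD` and κ(k) = 0 remove the terms with k in the second
  -- slot of W, and the two remaining gradient terms add up to 2σ.
  have hsym : ∀ a b, U b * κ a + κ b * U a = (r + 2 * σ) * (κ a * κ b) := by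
    intro a b
    have h1 := hA a b
    have h2 := hD b
    have h3 := hκ a
    simp only [hU, hr, hT, hσ, Fin.sum_univ_three] at h1 h2 h3 hk ⊢
    rw [hG a 0, hG a 1, hG a 2] at h3
    linear_combination h1 + κ a * h2 + (W b a - q b * κ a - σ * G b a) * hk
      - 2 * σ * κ b * h3
  -- Contracting `hsym` with l once, then twice, gives U = lam κ and the value of lam.
  set lam := ∑ a, l a * U a with hlam
  have hUl : ∀ b, U b + κ b * lam = (r + 2 * σ) * κ b := by
    intro b
    have h0 := hsym 0 b
    have h1 := hsym 1 b
    have h2 := hsym 2 b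
    simp only [hlam, Fin.sum_univ_three] at hl ⊢
    linear_combination l 0 * h0 + l 1 * h1 + l 2 * h2 + ((r + 2 * σ) * κ b - U b) * hl
  have hlam2 : 2 * lam = r + 2 * σ := by
    have h0 := hUl 0
    have h1 := hUl 1
    have h2 := hUl 2
    simp only [Fin.sum_univ_three] at hl hlam
    linear_combination l 0 * h0 + l 1 * h1 + l 2 * h2 + hlam - (lam - r - 2 * σ) * hl
  have hUb : ∀ b, U b = lam * κ b := fun b => by
    linear_combination hUl b - κ b * hlam2
  set N := ∑ b, ∑ a, n b * n a * W b a with hN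
  -- The divergence of T; by `hD` the metric trace of W is lam - 2N.
  have hdiv : ∀ b, U b + κ b * (lam - 2 * N) - r * κ b = 2 * σ * κ b := by
    intro b
    have h1 := hB b
    rw [hf.inv_eq] at h1
    have hinner : ∀ c, ∑ a, (vecMulVec k l + vecMulVec l k - (2 : ℂ) • vecMulVec n n) c a * T c b a
        = k c * W c b + κ b * (∑ a, k c * l a * W c a) - k c * q c * κ b
          - 2 * κ b * ∑ a, n c * n a * W c a := by
      intro c
      have hc := hD c
      simp only [Matrix.sub_apply, Matrix.add_apply, Matrix.smul_apply, vecMulVec_apply, hT,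
        Fin.sum_univ_three, smul_eq_mul] at hc hk hl hn ⊢
      linear_combination (k c * W c b - k c * q c * κ b) * hl
        + (l c * W c b - l c * q c * κ b) * hk
        - 2 * (n c * W c b - n c * q c * κ b) * hn + l c * κ b * hc
    simp only [hinner] at h1
    simp only [hU, hlam, hr, hN, Fin.sum_univ_three] at h1 ⊢
    linear_combination h1 + 2 * hσ b
  have hN0 : N = 0 := by
    have hb : ∀ b, κ b * N = 0 := fun b => by
      linear_combination (-1 / 2 : ℂ) * (hdiv b - hUb b - κ b * hlam2)
    have h0 := hb 0
    have h1 := hb 1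
    have h2 := hb 2
    simp only [Fin.sum_univ_three] at hl
    linear_combination l 0 * h0 + l 1 * h1 + l 2 * h2 - N * hl
  -- X and Y are orthogonal to k, hence combinations of k and n, and W is zero on each pair of
  -- these.
  have hX' := hf.expand X
  have hY' := hf.expand Y
  rw [hdot, hX] at hX'
  rw [hdot, hY] at hY'
  set x := Matrix.toBilin' G l X
  set z := Matrix.toBilin' G n X
  set x' := Matrix.toBilin' G l Y
  set z' := Matrix.toBilin' G n Y
  have eX : ∀ a, X a = x * k a - 2 * z * n a := fun a => by
    conv_lhs => rw [hX']
    simp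
  have eY : ∀ a, Y a = x' * k a - 2 * z' * n a := fun a => by
    conv_lhs => rw [hY']
    simp
  have d0 := hD 0
  have d1 := hD 1
  have d2 := hD 2
  have u0 := hUb 0
  have u1 := hUb 1
  have u2 := hUb 2
  simp only [eX, eY]
  simp only [hU, hN, Fin.sum_univ_three] at d0 d1 d2 u0 u1 u2 hn hN0 ⊢
  linear_combination x' * ((x * k 0 - 2 * z * n 0) * d0 + (x * k 1 - 2 * z * n 1) * d1
      + (x * k 2 - 2 * z * n 2) * d2)
    - 2 * x * z' * (n 0 * u0 + n 1 * u1 + n 2 * u2) - 2 * x * z' * lam * hn + 4 * z * z' * hN0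

end matrices

/-! ### The theorem in a coordinate domain -/

namespace SmoothMetricOn

variable {Ω : Set E3} {G : E3 → Matrix (Fin 3) (Fin 3) ℂ} (h : SmoothMetricOn Ω G)
include h

/-- Both `schouten` and `tfRicci` have this shape; as ∇g = 0, the scalar factor contributes only its
gradient. -/
theorem covDeriv₂_const_mul_sub {T : Fin 3 → Fin 3 → E3 → ℂ} {f : E3 → ℂ} (s : ℂ)
    (hT : ∀ a b, ContDiffOn ℝ ∞ (T a b) Ω) (hf : ContDiffOn ℝ ∞ f Ω) (c a b : Fin 3) {y : E3}
    (hy : y ∈ Ω) :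
    covDeriv₂ G (fun i j x => s * T i j x - f x * G x i j) c a b y =
      s * covDeriv₂ G T c a b y - pd c f y * G y a b := by
  have hm := h.covDeriv₂_metric c a b hy
  have hpd : pd c (fun x => s * T a b x - f x * G x a b) y =
      s * pd c (T a b) y - (pd c f y * G y a b + f y * pd c (fun x => G x a b) y) := by
    rw [pd_sub h.isOpen (contDiffOn_const.mul (hT a b)) (hf.mul (h.smooth a b)) c hy,
      pd_const_mul h.isOpen (hT a b) s c hy, pd_mul h.isOpen hf (h.smooth a b) c hy]
  simp only [covDeriv₂, Fin.sum_univ_three] at hm ⊢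
  rw [hpd]
  linear_combination (-f y) * hm

theorem covDeriv₂_schouten (c a b : Fin 3) {y : E3} (hy : y ∈ Ω) :
    covDeriv₂ G (schouten G) c a b y =
      - covDeriv₂ G (tfRicci G) c a b y - pd c (scalarS G) y * G y a b := by
  have hs : schouten G = fun i j x => (-1) * tfRicci G i j x - scalarS G x * G x i j := by
    funext i j x
    simp [schouten]
  rw [hs, h.covDeriv₂_const_mul_sub _ h.smooth_tfRicci h.smooth_scalarS c a b hy]
  ring

theorem covDeriv₂_tfRicci (c a b : Fin 3) {y : E3} (hy : y ∈ Ω) :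
    covDeriv₂ G (tfRicci G) c a b y =
      covDeriv₂ G (ricci G) c a b y - (1 / 3) * pd c (scalarR G) y * G y a b := by
  have hs : tfRicci G = fun i j x => 1 * ricci G i j x - (1 / 3 * scalarR G x) * G x i j := by
    funext i j x
    simp [tfRicci]
  rw [hs, h.covDeriv₂_const_mul_sub _ h.smooth_ricci (contDiffOn_const.mul h.smooth_scalarR)
    c a b hy, pd_const_mul h.isOpen h.smooth_scalarR _ c hy]
  ring

theorem sum_inv_mul (b c : Fin 3) {y : E3} (hy : y ∈ Ω) :
    ∑ a, (G y)⁻¹ c a * G y b a = if c = b then 1 else 0 := by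
  have := congrFun (congrFun (h.inv_mul hy) c) b
  rw [Matrix.mul_apply, Matrix.one_apply] at this
  simpa only [h.apply_comm hy b] using this

theorem trace_tfRicci {y : E3} (hy : y ∈ Ω) :
    ∑ a, ∑ b, (G y)⁻¹ a b * tfRicci G a b y = 0 := by
  have hi := fun a => h.sum_inv_mul a a hy
  simp only [if_true] at hi
  have h1 : ∀ a, ∑ b, (G y)⁻¹ a b * tfRicci G a b y =
      ∑ b, (G y)⁻¹ a b * ricci G a b y - (1 / 3) * scalarR G y := by
    intro a
    have e1 : (1 / 3) * scalarR G y =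
        ∑ b, (1 / 3) * scalarR G y * ((G y)⁻¹ a b * G y a b) := by
      rw [← Finset.mul_sum, hi, mul_one]
    rw [e1, ← Finset.sum_sub_distrib]
    exact Finset.sum_congr rfl fun b _ => by rw [tfRicci]; ring
  simp only [h1, Finset.sum_sub_distrib]
  rw [← scalarR]
  simp

theorem tfRicci_comm (a b : Fin 3) {y : E3} (hy : y ∈ Ω) :
    tfRicci G a b y = tfRicci G b a y := by
  rw [tfRicci, tfRicci, h.ricci_comm a b hy, h.apply_comm hy a b]

/-- The contracted Bianchi identity for the trace-free Ricci tensor. -/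
theorem div_tfRicci (b : Fin 3) {y : E3} (hy : y ∈ Ω) :
    ∑ c, ∑ a, (G y)⁻¹ c a * covDeriv₂ G (tfRicci G) c b a y = 2 * pd b (scalarS G) y := by
  have hS : pd b (scalarS G) y = (1 / 12) * pd b (scalarR G) y := by
    have : scalarS G = fun x => (1 / 12) * scalarR G x := by
      funext x
      rw [scalarS]; ring
    rw [this, pd_const_mul h.isOpen h.smooth_scalarR _ b hy]
  have h1 : ∀ c, ∑ a, (G y)⁻¹ c a * covDeriv₂ G (tfRicci G) c b a y =
      ∑ a, (G y)⁻¹ c a * covDeriv₂ G (ricci G) c b a y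
        - (1 / 3) * pd c (scalarR G) y * (if c = b then 1 else 0) := by
    intro c
    rw [← h.sum_inv_mul b c hy, Finset.mul_sum, ← Finset.sum_sub_distrib]
    exact Finset.sum_congr rfl fun a _ => by rw [h.covDeriv₂_tfRicci c b a hy]; ring
  simp only [h1, Finset.sum_sub_distrib, mul_ite, mul_one, mul_zero, Finset.sum_ite_eq',
    Finset.mem_univ, if_true]
  rw [hS]
  -- The coefficient is 1/2 - 1/3 = 1/6 of ∇R, that is, 2∇S.
  linear_combination (1 / 2 : ℂ) * h.contracted_bianchi b hy

/-- If the trace-free Ricci tensor has rank one and the curvature conditions hold at `y`, then the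
null vector that it determines is orthogonal to `∇_X Y`. -/
theorem coGeodetic_at {y : E3} (hy : y ∈ Ω)
    (hrank : ∀ x ∈ Ω, ∀ a b c d, tfRicci G a b x * tfRicci G c d x =
      tfRicci G a d x * tfRicci G c b x)
    {k l n κ : Fin 3 → ℂ} (hf : NullTriple (Matrix.toBilin' (G y)) k l n)
    (hκ : ∀ a, κ a = ∑ b, G y a b * k b)
    (hΦ : ∀ a b, tfRicci G a b y = 2 * (κ a * κ b))
    (hA : ∀ a b, ∑ c, k c * (cotton G a b c y - G y c a * pd b (scalarS G) y) = 0)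
    (hS : ∀ a b, κ a * pd b (scalarS G) y - κ b * pd a (scalarS G) y = 0)
    {Ω' : Set E3} (hΩ' : IsOpen Ω') (hsub : Ω' ⊆ Ω) (hy' : y ∈ Ω') {X Y : E3 → Fin 3 → ℂ}
    (hYs : ContDiffOn ℝ ∞ Y Ω')
    (hX : ∑ a, κ a * X y a = 0)
    (hY : ∀ x ∈ Ω', ∀ b, ∑ a, tfRicci G a b x * Y x a = 0) :
    ∑ a, κ a * nablaVec G X Y y a = 0 := by
  -- The vector l is frozen at its value at y, so w is a smooth multiple of the null covector
  -- obtained without a square root.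
  set w : Fin 3 → E3 → ℂ := fun a x => ∑ b, tfRicci G a b x * l b with hw
  set ψ : E3 → ℂ := fun x => ∑ a, w a x * l a with hψ
  have hws : ∀ a, ContDiffOn ℝ ∞ (w a) Ω := fun a =>
    ContDiffOn.sum fun b _ => (h.smooth_tfRicci a b).mul contDiffOn_const
  have hψs : ContDiffOn ℝ ∞ ψ Ω := ContDiffOn.sum fun a _ => (hws a).mul contDiffOn_const
  have hl : ∑ a, κ a * l a = 1 := by
    rw [← hf.lk, Matrix.toBilin'_apply]
    simp only [hκ, Fin.sum_univ_three]
    ring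
  have hk : ∑ a, κ a * k a = 0 := by
    rw [← hf.kk, Matrix.toBilin'_apply]
    simp only [hκ, Fin.sum_univ_three]
    ring
  have hwy : ∀ a, w a y = 2 * κ a := by
    intro a
    simp only [hw, hΦ, Fin.sum_univ_three] at hl ⊢
    linear_combination 2 * κ a * hl
  have hψy : ψ y = 2 := by
    simp only [hψ, hwy, Fin.sum_univ_three] at hl ⊢
    linear_combination 2 * hl
  have hww : ∀ a b, ∀ x ∈ Ω, w a x * w b x = ψ x * tfRicci G a b x := by
    intro a b x hx
    have hr := fun i j => hrank x hx a i j b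
    simp only [hψ, hw, Fin.sum_univ_three]
    simp only [h.tfRicci_comm b _ hx]
    linear_combination l 0 * l 0 * hr 0 0 + l 0 * l 1 * hr 0 1 + l 0 * l 2 * hr 0 2
      + l 1 * l 0 * hr 1 0 + l 1 * l 1 * hr 1 1 + l 1 * l 2 * hr 1 2
      + l 2 * l 0 * hr 2 0 + l 2 * l 1 * hr 2 1 + l 2 * l 2 * hr 2 2
  set W : Matrix (Fin 3) (Fin 3) ℂ :=
    Matrix.of fun c a => pd c (w a) y - ∑ e, christoffel G e c a y * w e y with hW
  -- Differentiate w⊗w = ψΦ at y, where w = 2κ and ψ = 2.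
  have hT : ∀ c a b, covDeriv₂ G (tfRicci G) c a b y =
      W c a * κ b + κ a * W c b - pd c ψ y * (κ a * κ b) := by
    intro c a b
    have h1 := pd_congr h.isOpen (hww a b) c hy
    rw [pd_mul h.isOpen (hws a) (hws b) c hy,
      pd_mul h.isOpen hψs (h.smooth_tfRicci a b) c hy] at h1
    simp only [hwy, hψy, hΦ] at h1
    simp only [covDeriv₂, hW, hwy, hΦ, Matrix.of_apply, Fin.sum_univ_three]
    linear_combination (-1 / 2 : ℂ) * h1
  have hinv : ∀ a, ∑ b, (G y)⁻¹ a b * κ b = k a := by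
    intro a
    have := congrFun (congrArg (fun A => Matrix.mulVec A k) (h.inv_mul hy)) a
    rw [← Matrix.mulVec_mulVec, Matrix.one_mulVec] at this
    rw [← this]
    simp only [hκ, Matrix.mulVec, dotProduct]
  -- Φ stays trace-free under ∇, and the trace of `hT` is 2 W(c, k) - q_c κ(k) with κ(k) = 0.
  have hD : ∀ c, ∑ a, W c a * k a = 0 := by
    intro c
    have h1 := h.pd_trace h.smooth_tfRicci c hy
    rw [pd_congr h.isOpen (fun x hx => h.trace_tfRicci hx) c hy, pd_const] at h1
    have hG : ∀ a b, (G y)⁻¹ a b = (G y)⁻¹ b a := fun a b =>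
      congrFun (congrFun (h.inv_transpose hy) b) a
    have i0 := hinv 0
    have i1 := hinv 1
    have i2 := hinv 2
    simp only [hT, Fin.sum_univ_three, hG 1 0, hG 2 0, hG 2 1] at h1 i0 i1 i2 hk ⊢
    linear_combination (-1 / 2 : ℂ) * h1 - (W c 0 - pd c ψ y * κ 0 / 2) * i0
      - (W c 1 - pd c ψ y * κ 1 / 2) * i1
      - (W c 2 - pd c ψ y * κ 2 / 2) * i2 + pd c ψ y / 2 * hk
  have hA' : ∀ a b, ∑ c, k c * ((-covDeriv₂ G (tfRicci G) b c a y
      - pd b (scalarS G) y * G y c a + covDeriv₂ G (tfRicci G) c b a y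
      + pd c (scalarS G) y * G y b a) - G y c a * pd b (scalarS G) y) = 0 := by
    intro a b
    rw [← hA a b]
    refine Finset.sum_congr rfl fun c _ => ?_
    rw [cotton, h.covDeriv₂_schouten b c a hy, h.covDeriv₂_schouten c b a hy]
    ring
  have hwY : ∀ x ∈ Ω', ∑ a, w a x * Y x a = 0 := by
    intro x hx
    have t0 := hY x hx 0
    have t1 := hY x hx 1
    have t2 := hY x hx 2
    simp only [hw, Fin.sum_univ_three] at t0 t1 t2 ⊢
    linear_combination l 0 * t0 + l 1 * t1 + l 2 * t2
  have hYy : ∑ a, κ a * Y y a = 0 := by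
    have := hwY y hy'
    simp only [hwy, Fin.sum_univ_three] at this ⊢
    linear_combination this / 2
  have hYa : ∀ a, ContDiffOn ℝ ∞ (fun x => Y x a) Ω' := fun a => contDiffOn_pi.1 hYs a
  -- Differentiating w(Y) = 0 moves the derivative from Y to w.
  have hder : ∀ b, ∑ a, (pd b (w a) y * Y y a + w a y * pd b (fun x => Y x a) y) = 0 := by
    intro b
    have h1 := pd_congr hΩ' hwY b hy'
    rw [pd_const, pd_sum hΩ' _ (fun a _ => ((hws a).mono hsub).mul (hYa a)) b hy'] at h1
    rw [← h1]
    exact Finset.sum_congr rfl fun a _ =>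
      (pd_mul hΩ' ((hws a).mono hsub) (hYa a) b hy').symm
  have main := hf.derivative_vanishes (X := X y) (Y := Y y) hκ (h.apply_comm hy) hT hD hS hA'
    (fun b => h.div_tfRicci b hy) hX hYy
  have d0 := hder 0
  have d1 := hder 1
  have d2 := hder 2
  simp only [hwy, Fin.sum_univ_three] at d0 d1 d2
  simp only [nablaVec, hW, hwy, Matrix.of_apply, Fin.sum_univ_three] at main ⊢
  linear_combination (-1 / 2 : ℂ) * main + (X y 0 * d0 + X y 1 * d1 + X y 2 * d2) / 2

end SmoothMetricOn

/-! ### Passage to charts -/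

section Manifold

variable {M : Type*} [TopologicalSpace M] [ChartedSpace E3 M]
  {e : OpenPartialHomeomorph M E3}

theorem ComplexMetric.Phi_eq (g : ComplexMetric M) {y : E3} (hy : y ∈ e.target) (v w : CTangent (e.symm y)) :
    g.Phi e (e.symm y) v w =
      Matrix.toBilin' (Matrix.of fun a b => tfRicci (g.comp e) a b y)
        (coord e (e.symm y) v) (coord e (e.symm y) w) := by
  rw [ComplexMetric.Phi, e.right_inv hy, Matrix.toBilin'_apply]
  exact Finset.sum_congr rfl fun a _ => Finset.sum_congr rfl fun b _ => by
    rw [Matrix.of_apply]; ring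

theorem ComplexMetric.comp_symm (g : ComplexMetric M) {y : E3} : (g.comp e y).transpose = g.comp e y := by
  ext a b
  exact (g.symm (e.symm y)).eq _ _

variable [IsManifold (𝓡 3) ∞ M]

theorem mdifferentiable_chart (he : e ∈ atlas E3 M) : e.MDifferentiable (𝓡 3) (𝓡 3) := by
  have : IsManifold (𝓡 3) 1 M := IsManifold.of_le (n := ∞) (by simp)
  exact mdifferentiable_of_mem_atlas he

theorem coord_coordVec (he : e ∈ atlas E3 M) {y : E3} (hy : y ∈ e.target) (i : Fin 3) :
    coord e (e.symm y) (coordVec e y i) = Pi.single i 1 := by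
  have h1 : dChart e (e.symm y) (dChartSymm e y (EuclideanSpace.single i (1 : ℝ))) =
      EuclideanSpace.single i (1 : ℝ) := by
    have := (mdifferentiable_chart he).comp_symm_deriv hy
    exact congrArg (fun f => f (EuclideanSpace.single i (1 : ℝ))) this
  ext j
  by_cases hij : j = i <;> simp [coord, coordVec, h1, hij]

theorem coord_injective (he : e ∈ atlas E3 M) {y : E3} (hy : y ∈ e.target) :
    Function.Injective (coord e (e.symm y)) := by
  have h1 : (mfderiv (𝓡 3) (𝓡 3) e.symm (e (e.symm y))).toLinearMap ∘ₗ dChart e (e.symm y) =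
      LinearMap.id := by
    have := (mdifferentiable_chart he).symm_comp_deriv (e.map_target hy)
    exact congrArg ContinuousLinearMap.toLinearMap this
  have h2 : Function.Injective (dChart e (e.symm y)) := by
    intro u v huv
    have := congrArg (mfderiv (𝓡 3) (𝓡 3) e.symm (e (e.symm y))).toLinearMap huv
    exact (LinearMap.congr_fun h1 u).symm.trans (this.trans (LinearMap.congr_fun h1 v))
  have h3 : Function.Injective (LinearMap.baseChange ℂ (dChart e (e.symm y))) :=
    Module.Flat.lTensor_preserves_injective_linearMap _ h2
  rw [coord, LinearMap.coe_comp]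
  exact (LinearEquiv.injective _).comp h3

theorem eq_sum_coordVec (he : e ∈ atlas E3 M) {y : E3} (hy : y ∈ e.target)
    (v : CTangent (e.symm y)) :
    v = ∑ i, coord e (e.symm y) v i • coordVec e y i := by
  apply coord_injective he hy
  simp only [map_sum, map_smul, coord_coordVec he hy]
  ext j
  simp [Finset.sum_apply, Pi.single_apply]

variable (g : ComplexMetric M)

theorem ComplexMetric.form_eq (he : e ∈ atlas E3 M) {y : E3} (hy : y ∈ e.target)
    (v w : CTangent (e.symm y)) :
    g.form (e.symm y) v w =
      Matrix.toBilin' (g.comp e y) (coord e (e.symm y) v) (coord e (e.symm y) w) := by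
  conv_lhs => rw [eq_sum_coordVec he hy v, eq_sum_coordVec he hy w]
  simp only [map_sum, map_smul, LinearMap.sum_apply, LinearMap.smul_apply, smul_eq_mul,
    Matrix.toBilin'_apply, Finset.mul_sum]
  rw [Finset.sum_comm]
  refine Finset.sum_congr rfl fun i _ => Finset.sum_congr rfl fun j _ => ?_
  simp only [ComplexMetric.comp, coordForm, Matrix.of_apply]
  ring

variable {g}

theorem IsNullFrame.nullTriple (he : e ∈ atlas E3 M) {y : E3} (hy : y ∈ e.target)
    {k l n : CTangent (e.symm y)} (hf : IsNullFrame g (e.symm y) k l n) :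
    NullTriple (Matrix.toBilin' (g.comp e y)) (coord e (e.symm y) k) (coord e (e.symm y) l)
      (coord e (e.symm y) n) := by
  have hs : ∀ v w, g.form (e.symm y) v w = g.form (e.symm y) w v := fun v w =>
    (g.symm (e.symm y)).eq v w
  constructor <;> rw [← g.form_eq he hy]
  exacts [hf.kk, hf.ll, hf.nn, hf.kl, (hs _ _).trans hf.kl, hf.kn, (hs _ _).trans hf.kn, hf.ln,
    (hs _ _).trans hf.ln]

/-- The null frame supplied by type N inverts the component matrix, whence the nonzero determinant.
-/
theorem ComplexMetric.smoothMetricOn (he : e ∈ atlas E3 M) (htype : ∀ p : M, g.IsTypeNAt p) :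
    SmoothMetricOn e.target (g.comp e) where
  isOpen := e.open_target
  smooth := fun a b => g.smooth e he a b
  symm := fun _ _ => g.comp_symm
  det_ne := fun y hy => by
    obtain ⟨k, l, n, hf, -⟩ := htype (e.symm y) e he (e.map_target hy)
    exact (Matrix.isUnit_det_of_left_inverse (hf.nullTriple he hy).mul_eq_one).ne_zero

/-- At a point of type N where `N` is principal there is a null frame adapted to `N` in which the
trace-free Ricci tensor is `2 κ ⊗ κ` with `κ` the covector of a vector spanning `N`. -/
theorem exists_adapted_frame (he : e ∈ atlas E3 M) (N : NullStructure g)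
    (hmult : ∀ p : M, N.IsMultiplePrincipalAt p) (htype : ∀ p : M, g.IsTypeNAt p)
    {y : E3} (hy : y ∈ e.target) :
    ∃ k l n : Fin 3 → ℂ, NullTriple (Matrix.toBilin' (g.comp e y)) k l n ∧
      (∀ a b, tfRicci (g.comp e) a b y =
        2 * ((∑ c, g.comp e y a c * k c) * ∑ c, g.comp e y b c * k c)) ∧
      (∃ ζ ∈ N.line (e.symm y), coord e (e.symm y) ζ = k) ∧
      ∀ ξ ∈ N.line (e.symm y), ∃ r : ℂ, coord e (e.symm y) ξ = r • k := by
  have hG := ComplexMetric.smoothMetricOn he htype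
  obtain ⟨k, l, n, hf, α, β, hne, hquart⟩ := htype (e.symm y) e he (e.map_target hy)
  have hf' := hf.nullTriple he hy
  set Φ : Matrix (Fin 3) (Fin 3) ℂ := Matrix.of fun a b => tfRicci (g.comp e) a b y with hΦ
  have hΦs : Φ.transpose = Φ := by
    ext a b
    exact hG.tfRicci_comm b a hy
  have hQ : ∀ v w, Matrix.toBilin' Φ v w = Matrix.toBilin' Φ w v := by
    intro v w
    rw [Matrix.toBilin'_apply', Matrix.toBilin'_apply', Matrix.dotProduct_mulVec,
      ← Matrix.mulVec_transpose, hΦs, dotProduct_comm]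
  have htr : Matrix.toBilin' Φ (coord e (e.symm y) k) (coord e (e.symm y) l)
      + Matrix.toBilin' Φ (coord e (e.symm y) l) (coord e (e.symm y) k)
      - 2 * Matrix.toBilin' Φ (coord e (e.symm y) n) (coord e (e.symm y) n) = 0 := by
    rw [← hG.trace_tfRicci hy, hf'.inv_eq]
    simp only [Matrix.toBilin'_apply, hΦ, Matrix.of_apply, Matrix.sub_apply, Matrix.add_apply,
      Matrix.smul_apply, Matrix.vecMulVec_apply, smul_eq_mul, Fin.sum_univ_three]
    ring
  have hquart' : ∀ s t : ℂ, Matrix.toBilin' Φ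
      (s ^ 2 • coord e (e.symm y) k + (2 * s * t) • coord e (e.symm y) n
        + t ^ 2 • coord e (e.symm y) l)
      (s ^ 2 • coord e (e.symm y) k + (2 * s * t) • coord e (e.symm y) n
        + t ^ 2 • coord e (e.symm y) l) / 2 = (α * s + β * t) ^ 4 := by
    intro s t
    rw [← hquart s t, g.Phi_eq hy]
    simp only [nullVec, map_add, map_smul]
    rfl
  obtain ⟨K, L, n', hF, hK⟩ := hf'.exists_adapted hf'.expand hQ htr hne hquart'
  have hdot : ∀ v, Matrix.toBilin' (g.comp e y) K v =
      ∑ a, (∑ c, g.comp e y a c * K c) * v a := by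
    intro v
    rw [Matrix.toBilin'_apply]
    simp only [Fin.sum_univ_three, hG.apply_comm hy 1 0, hG.apply_comm hy 2 0,
      hG.apply_comm hy 2 1]
    ring
  -- Φ(ξ, ξ) is twice the square of the product of K and ξ, so a principal ξ is orthogonal to K;
  -- being null, it is a multiple of K.
  have hline : ∀ ξ ∈ N.line (e.symm y), ∃ r : ℂ, coord e (e.symm y) ξ = r • K := by
    intro ξ hξ
    have h1 := (hmult (e.symm y)).1 e he (e.map_target hy) ξ hξ
    rw [g.Phi_eq hy] at h1
    have h2 := hK (coord e (e.symm y) ξ) (coord e (e.symm y) ξ)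
    rw [h1] at h2
    have h3 : Matrix.toBilin' (g.comp e y) K (coord e (e.symm y) ξ) = 0 := by
      simpa using h2.symm
    have h4 := N.null (e.symm y) ξ hξ
    rw [g.form_eq he hy] at h4
    exact ⟨_, hF.eq_smul_of_null hF.expand h3 h4⟩
  refine ⟨K, L, n', hF, fun a b => ?_, ?_, hline⟩
  · have := hK (Pi.single a 1) (Pi.single b 1)
    rw [hdot, hdot, Matrix.toBilin'_single, hΦ, Matrix.of_apply] at this
    simpa [Pi.single_apply] using this
  -- The fibre is nonzero, so rescaling one of its vectors reaches K itself.
  · have hpos : 0 < Module.finrank ℂ (N.line (e.symm y)) := by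
      rw [N.finrank_line]; exact one_pos
    have := Module.nontrivial_of_finrank_pos hpos
    obtain ⟨⟨ξ, hξ⟩, hξ0⟩ := exists_ne (0 : N.line (e.symm y))
    obtain ⟨r, hr⟩ := hline ξ hξ
    have hr0 : r ≠ 0 := by
      rintro rfl
      rw [zero_smul, ← map_zero (coord e (e.symm y))] at hr
      exact hξ0 (Subtype.ext (coord_injective he hy hr))
    refine ⟨r⁻¹ • ξ, Submodule.smul_mem _ _ hξ, ?_⟩
    rw [map_smul, hr, smul_smul, inv_mul_cancel₀ hr0, one_smul]

end Manifold

end NullGeometry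

theorem mainTheorem7 {M : Type*} [TopologicalSpace M] [ChartedSpace NullGeometry.E3 M]
    [IsManifold (𝓡 3) ∞ M] (g : NullGeometry.ComplexMetric M)
    (N : NullGeometry.NullStructure g)
    (hmult : ∀ p : M, N.IsMultiplePrincipalAt p)
    (htype : ∀ p : M, g.IsTypeNAt p)
    (hcond : ∀ p : M, N.TypeNConditionAt p) :
    N.IsCoGeodetic := by
  intro U hU X Y Z _ hYs _ hX hY hZ e he q hq hqU
  obtain ⟨y, hy, rfl⟩ : ∃ y ∈ e.target, e.symm y = q := ⟨e q, e.map_source hq, e.left_inv hq⟩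
  have hG := NullGeometry.ComplexMetric.smoothMetricOn he htype
  rw [e.right_inv hy]
  have hperp : ∀ x ∈ e.target, ∀ (k : Fin 3 → ℂ),
      (∃ ζ ∈ N.line (e.symm x), NullGeometry.coord e (e.symm x) ζ = k) →
      ∀ v ∈ N.perp (e.symm x),
        ∑ a, (∑ c, g.comp e x a c * k c) * NullGeometry.coord e (e.symm x) v a = 0 := by
    rintro x hx k ⟨ζ, hζ, rfl⟩ v hv
    have h1 := hv ζ hζ
    rw [g.form_eq he hx, Matrix.toBilin'_apply] at h1
    rw [← h1]
    refine Finset.sum_congr rfl fun a _ => ?_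
    rw [Finset.sum_mul]
    exact Finset.sum_congr rfl fun b _ => by ring
  -- Rank one is stated through Φ alone, since the adapted frames are chosen pointwise and need not
  -- vary smoothly.
  have hrank : ∀ x ∈ e.target, ∀ a b c d,
      NullGeometry.tfRicci (g.comp e) a b x * NullGeometry.tfRicci (g.comp e) c d x =
      NullGeometry.tfRicci (g.comp e) a d x * NullGeometry.tfRicci (g.comp e) c b x := by
    intro x hx a b c d
    obtain ⟨k, l, n, -, hΦ, -⟩ := NullGeometry.exists_adapted_frame he N hmult htype hx
    simp only [hΦ]
    ring
  obtain ⟨k, l, n, hf, hΦ, hζ, hline⟩ := NullGeometry.exists_adapted_frame he N hmult htype hy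
  obtain ⟨r, hr⟩ := hline _ (hZ _ hqU)
  have hkX := hperp y hy k hζ _ (hX _ hqU)
  obtain ⟨ζ, hζN, hζk⟩ := hζ
  have hc := hcond (e.symm y) e he (e.map_target hy) ζ hζN
  rw [e.right_inv hy, hζk] at hc
  obtain ⟨hA, -, hS⟩ := hc
  have main := hG.coGeodetic_at hy hrank hf (fun _ => rfl) hΦ hA hS
    (e.isOpen_inter_preimage_symm hU) Set.inter_subset_left ⟨hy, hqU⟩
    (X := NullGeometry.coordField e X) (hYs e he) hkX
    (fun x hx b => by
      obtain ⟨k', l', n', -, hΦ', hζ', -⟩ :=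
        NullGeometry.exists_adapted_frame he N hmult htype hx.1
      have h1 := hperp x hx.1 k' hζ' _ (hY _ hx.2)
      rw [← mul_zero (2 * ∑ c, g.comp e x b c * k' c), ← h1, Finset.mul_sum (s := Finset.univ)
        (a := 2 * ∑ c, g.comp e x b c * k' c)]
      refine Finset.sum_congr rfl fun a _ => ?_
      rw [hΦ', NullGeometry.coordField]
      ring)
  -- Z is r times the adapted vector k at this point.
  have h2 := congrArg (fun z => r * z) main
  simp only [mul_zero] at h2
  rw [← h2, hr, Finset.mul_sum]
  refine Finset.sum_congr rfl fun a _ => ?_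
  rw [Finset.sum_mul, Finset.mul_sum]
  exact Finset.sum_congr rfl fun b _ => by
    rw [Pi.smul_apply, smul_eq_mul]; ring
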